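/- Let $K$ be an algebraically closed field of characteristic $0$, let $f_0,\dots,f_n\in K[x_0,\dots,x_n]$ be a regular sequence of homogeneous polynomials of degree $2$, and let $R=K[x_0,\dots,x_n]/(f_0,\dots,f_n)=\bigoplus_i R^i$ with its standard grading. For $j\ge 0$ let $\mathcal N_j=\{[x]\in\mathbb P(R^1)\mid x^j=0\}$. For $X\subseteq \mathbb P(R^1)$ let $\mathrm{Sec}^k(X)$ be the Zariski closure in $\mathbb P(R^1)$ of the union of the linear spans $\langle p_1,\dots,p_k\rangle$ over all $p_1,\dots,p_k\in X$. Let $k\ge 2$ and let $\pi\subseteq\mathbb P(R^1)$ be a $(k-1)$-plane (a projective linear subspace of dimension $k-1$) contained in $\mathcal N_{k+1}$. Put $T_k=\pi\cap\mathcal N_k$. Then: (A) $T_k$ is a hypersurface of degree $k$ in $\pi$, possibly with multiple components. That is, for every basis $b_0,\dots,b_{k-1}$ of the vector subspace of $R^1$ underlying $\pi$, there is a nonzero homogeneous polynomial $p\in K[\alpha_0,\dots,\alpha_{k-1}]$ of degree $k$ such that the ideal generated by the coordinates of $(\alpha_0b_0+\dots+\alpha_{k-1}b_{k-1})^k$ with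 respect to a $K$-basis of $R$ is the principal ideal $(p)$; in particular a point $[\sum_i a_ib_i]$ of $\pi$ lies in $T_k$ if and only if $p(a_0,\dots,a_{k-1})=0$. (B) There exist linearly independent $[x_0],\dots,[x_{k-1}]\in T_k$ with $\prod_{i=0}^{k-1}x_i\ne 0$ in $R$. In particular, $T_k$ is nondegenerate in $\pi$ (its linear span is $\pi$), and $\pi\subseteq\mathrm{Sec}^k(\mathcal N_k)$. -/

import Mathlib

noncomputable section

/-- `f` is a regular sequence of `n + 1` quadratic forms in `n + 1` variables. -/
structure IsQuadricRegularSequence {K : Type*} [Field K] {n : ℕ}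
    (f : Fin (n + 1) → MvPolynomial (Fin (n + 1)) K) : Prop where
  isHomogeneous : ∀ i, (f i).IsHomogeneous 2
  isRegular : RingTheory.Sequence.IsRegular (MvPolynomial (Fin (n + 1)) K) (List.ofFn f)

/-- The algebra `R = K[x₀, …, xₙ] / (f₀, …, fₙ)`. -/
abbrev CIAlgebra {K : Type*} [Field K] {n : ℕ}
    (f : Fin (n + 1) → MvPolynomial (Fin (n + 1)) K) : Type _ :=
  MvPolynomial (Fin (n + 1)) K ⧸ Ideal.span (Set.range f)

/-- The graded piece `R^d`: the classes of the forms of degree `d`. -/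
def gradedPiece {K : Type*} [Field K] {n : ℕ}
    (f : Fin (n + 1) → MvPolynomial (Fin (n + 1)) K) (d : ℕ) : Submodule K (CIAlgebra f) :=
  (MvPolynomial.homogeneousSubmodule (Fin (n + 1)) K d).map
    (Ideal.Quotient.mkₐ K (Ideal.span (Set.range f))).toLinearMap

/-- The nihilpotent locus `{[x] ∈ ℙ(V) | x ^ k = 0}` of a subspace `V` of an algebra `R`
(used with `V = R^1`). -/
def nilpotentLocus {K R : Type*} [Field K] [CommRing R] [Algebra K R] (V : Submodule K R)
    (k : ℕ) : Set (Projectivization K V) :=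
  {x | ((x.rep : V) : R) ^ k = 0}

/-- Membership in the nihilpotent locus does not depend on the representative. -/
theorem mk_mem_nilpotentLocus {K R : Type*} [Field K] [CommRing R] [Algebra K R]
    (V : Submodule K R) (k : ℕ) (v : V) (hv : v ≠ 0) :
    Projectivization.mk K v hv ∈ nilpotentLocus V k ↔ (v : R) ^ k = 0 := by
  obtain ⟨a, ha⟩ := Projectivization.exists_smul_eq_mk_rep K v hv
  have h : (((Projectivization.mk K v hv).rep : V) : R) = (a : K) • (v : R) := by
    rw [← ha]; rfl
  have ha0 : (a : K) ^ k ≠ 0 := pow_ne_zero _ a.ne_zero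
  change (((Projectivization.mk K v hv).rep : V) : R) ^ k = 0 ↔ _
  rw [h, smul_pow, smul_eq_zero_iff_right ha0]

/-- Apply a linear functional to all the coefficients of a polynomial. -/
def applyCoeff {K R ι : Type*} [Field K] [CommRing R] [Algebra K R] (φ : R →ₗ[K] K)
    (p : MvPolynomial ι R) : MvPolynomial ι K :=
  ∑ m ∈ p.support, MvPolynomial.monomial m (φ (p.coeff m))

/-- The ideal, in the homogeneous coordinates `Xᵢ` with respect to `b`, of the scheme
`{[a] | (∑ aᵢ bᵢ) ^ k = 0}`: it is generated by all the coordinates (values of linear functionals)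
of the `k`-th power of the generic element `∑ Xᵢ bᵢ`. -/
def nilpotentIdeal {K R ι : Type*} [Field K] [CommRing R] [Algebra K R] [Fintype ι]
    (b : ι → R) (k : ℕ) : Ideal (MvPolynomial ι K) :=
  Ideal.span (Set.range fun φ : R →ₗ[K] K =>
    applyCoeff φ ((∑ i, MvPolynomial.C (b i) * MvPolynomial.X i) ^ k))

theorem eval_applyCoeff {K R ι : Type*} [Field K] [CommRing R] [Algebra K R] (φ : R →ₗ[K] K)
    (p : MvPolynomial ι R) (a : ι → K) :
    MvPolynomial.eval a (applyCoeff φ p) =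
      φ (MvPolynomial.eval (fun i => algebraMap K R (a i)) p) := by
  rw [MvPolynomial.eval_eq (fun i => algebraMap K R (a i)) p, applyCoeff, map_sum, map_sum]
  refine Finset.sum_congr rfl fun m _ => ?_
  rw [MvPolynomial.eval_monomial, Finsupp.prod, mul_comm, ← smul_eq_mul, ← map_smul,
    Algebra.smul_def, map_prod, mul_comm]
  simp only [map_pow]

/-- The zeros of `nilpotentIdeal b k` are the expected ones. -/
theorem eval_nilpotentIdeal_eq_zero_iff {K R ι : Type*} [Field K] [CommRing R] [Algebra K R]
    [Fintype ι] (b : ι → R) (k : ℕ) (a : ι → K) :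
    (∀ g ∈ nilpotentIdeal (K := K) b k, MvPolynomial.eval a g = 0) ↔
      (∑ i, a i • b i) ^ k = 0 := by
  have key : ∀ φ : R →ₗ[K] K, MvPolynomial.eval a
      (applyCoeff φ ((∑ i, MvPolynomial.C (b i) * MvPolynomial.X i) ^ k)) =
        φ ((∑ i, a i • b i) ^ k) := by
    intro φ
    rw [eval_applyCoeff]
    simp [Algebra.smul_def, mul_comm]
  constructor
  · intro h
    rw [← Module.forall_dual_apply_eq_zero_iff K]
    intro φ
    rw [← key φ]
    exact h _ (Ideal.subset_span ⟨φ, rfl⟩)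
  · intro h g hg
    have : nilpotentIdeal (K := K) b k ≤ RingHom.ker (MvPolynomial.eval a) := by
      rw [nilpotentIdeal, Ideal.span_le]
      rintro _ ⟨φ, rfl⟩
      change MvPolynomial.eval a _ = 0
      rw [key φ, h, map_zero]
    exact this hg

/-- The Zariski closure of a subset of `ℙ(V)`: the points at which all the forms vanish that vanish
on the subset. Forms on `V` are written as homogeneous polynomials in linear functionals. -/
def zariskiClosure {K V : Type*} [Field K] [AddCommGroup V] [Module K V]
    (S : Set (Projectivization K V)) : Set (Projectivization K V) :=
  {x | ∀ (d : ℕ) (F : MvPolynomial (Module.Dual K V) K), F.IsHomogeneous d →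
    (∀ y ∈ S, MvPolynomial.eval (fun φ : Module.Dual K V => φ y.rep) F = 0) →
      MvPolynomial.eval (fun φ : Module.Dual K V => φ x.rep) F = 0}

/-- The `k`-secant variety: the Zariski closure of the union of the linear spans of `k` points. -/
def secantVariety {K V : Type*} [Field K] [AddCommGroup V] [Module K V] (k : ℕ)
    (S : Set (Projectivization K V)) : Set (Projectivization K V) :=
  zariskiClosure {x | ∃ p : Fin k → Projectivization K V, (∀ i, p i ∈ S) ∧
    x ∈ Projectivization.Subspace.span (Set.range p)}

end

/-!
Write `S = K[x₀, …, xₙ]`, `I = (f₀, …, fₙ)` and let `W ⊆ R¹` be the `k`-dimensional space of `π`.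
Polarizing `u ^ (k + 1) = 0` shows that `W` annihilates every `u ^ k`, so everything rests on two
facts about the annihilator of `W` in `R`: it is zero in degrees below `k`, and in degree `k` it is
at most a line.

Abstractly these facts say that the annihilator of `W`, which is the `k`-th Koszul homology of `W`
on `R`, is also the `k`-th Koszul homology of `f₀, …, fₙ` on `S / (W)`. Only an injection from the
former to the latter is needed, and it is built one linear form at a time. If `x₀, …, x_{k - 1}` are
linear forms lifting a basis of `W`, a class `z` annihilated by `W` yields cochains
`c₀ = z, c₁, …, c_k` of the Koszul complex of `f` with `x_i c_i ≡ d c_{i + 1}` modulo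
`(x₀, …, x_{i - 1})` (`KoszulCochain.exists_isLift`); here the exactness of the Koszul complex of a
regular sequence enters (`KoszulCochain.exists_koszulD_eq`). If `c_k` vanishes, so does `z`
(`KoszulCochain.IsLift.mem_initialIdeal_of_boundary`). As the `f_a` are quadrics and the `x_i` are
linear, `c_k` has polynomial degree `deg z - k`. Hence `z = 0` if `deg z < k`. If `deg z = k`, then
`c_k` is a constant cochain in the `k`-th exterior power of the space of relations among the
`f_a` modulo `W`, and by Krull's height theorem there are at most `k` independent relations
(`MvPolynomial.exists_linearIndepOn_mkₐ`), so this power is at most a line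
(`MvPolynomial.constant_cochain_eq_zero`).

It follows that `u ^ k = p(u) w` on `W` for one form `p` of degree `k` and one element `w`. The
first fact also shows that `p ≠ 0` and that `p` is not a cone: if `y u ^ (k - 1) = 0` for all
`u ∈ W`, then one factor `u` after the other can be removed, down to `y = 0`. Therefore the zeros of
`p` do not lie in two hyperplanes with a common vector `y ≠ 0`: over an algebraically closed field,
`p` would be constant on almost every line in the direction `y`, which makes `y` a vertex
(`IsSocleTight.exists_pow_eq_zero_of_apply`). This allows one to choose independent zeros
`x₀, …, x_{k - 1}` of `p` with nonzero product one after the other. They span `π`, which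
gives the nondegeneracy and the statement on the secant variety.
-/

noncomputable section

/-! ### The Koszul complex of a sequence -/

namespace KoszulCochain

variable {S : Type*} [CommRing S]

/-- Cochains are written as functions `Finset ℕ → S`, the value at `T` being the coefficient of
the exterior monomial indexed by `T`. This is the sign `(-1) ^ #{t ∈ T | t < a}` with which the
exterior generator `a` is moved to its place in the monomial indexed by `T`. -/
def sign (S : Type*) [CommRing S] (a : ℕ) (T : Finset ℕ) : S :=
  (-1) ^ (T.filter (· < a)).card

theorem sign_mul_self (a : ℕ) (T : Finset ℕ) : sign S a T * sign S a T = 1 := by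
  rw [sign, ← mul_pow]; simp

theorem sign_insert_of_lt {a b : ℕ} {T : Finset ℕ} (h : a < b) (ha : a ∉ T) :
    sign S b (insert a T) = -sign S b T := by
  rw [sign, sign, Finset.filter_insert, if_pos h, Finset.card_insert_of_notMem (by simp [ha]),
    pow_succ, mul_neg_one]

theorem sign_insert_of_le {a b : ℕ} {T : Finset ℕ} (h : b ≤ a) :
    sign S b (insert a T) = sign S b T := by
  rw [sign, sign, Finset.filter_insert, if_neg (by omega)]

theorem sign_erase_of_le {a b : ℕ} {T : Finset ℕ} (h : b ≤ a) :
    sign S b (T.erase a) = sign S b T := by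
  by_cases ha : a ∈ T
  · conv_rhs => rw [← Finset.insert_erase ha]
    rw [sign_insert_of_le h]
  · rw [Finset.erase_eq_of_notMem ha]

/-- Contraction with the dual of the exterior generator `a`. -/
def contract (a : ℕ) : (Finset ℕ → S) →ₗ[S] (Finset ℕ → S) where
  toFun c T := if a ∈ T then 0 else sign S a T * c (insert a T)
  map_add' c c' := by ext T; by_cases h : a ∈ T <;> simp [h, mul_add]
  map_smul' s c := by ext T; by_cases h : a ∈ T <;> simp [h, mul_left_comm]

/-- Exterior multiplication with the generator `a`. -/
def wedge (a : ℕ) : (Finset ℕ → S) →ₗ[S] (Finset ℕ → S) where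
  toFun c T := if a ∈ T then sign S a T * c (T.erase a) else 0
  map_add' c c' := by ext T; by_cases h : a ∈ T <;> simp [h, mul_add]
  map_smul' s c := by ext T; by_cases h : a ∈ T <;> simp [h, mul_left_comm]

theorem contract_apply (a : ℕ) (c : Finset ℕ → S) (T : Finset ℕ) :
    contract a c T = if a ∈ T then 0 else sign S a T * c (insert a T) := rfl

theorem wedge_apply (a : ℕ) (c : Finset ℕ → S) (T : Finset ℕ) :
    wedge a c T = if a ∈ T then sign S a T * c (T.erase a) else 0 := rfl

theorem contract_contract_of_lt {a b : ℕ} (h : a < b) (c : Finset ℕ → S) :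
    contract a (contract b c) = -contract b (contract a c) := by
  ext T
  simp only [contract_apply, Pi.neg_apply, Finset.mem_insert]
  by_cases ha : a ∈ T <;> by_cases hb : b ∈ T <;> simp [ha, hb, h.ne, h.ne']
  rw [sign_insert_of_lt h ha, sign_insert_of_le h.le, Finset.insert_comm]
  ring

theorem contract_contract_self (a : ℕ) (c : Finset ℕ → S) : contract a (contract a c) = 0 := by
  ext T
  simp [contract_apply]

theorem contract_contract (a b : ℕ) (c : Finset ℕ → S) :
    contract a (contract b c) = -contract b (contract a c) := by
  rcases lt_trichotomy a b with h | rfl | h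
  · exact contract_contract_of_lt h c
  · simp [contract_contract_self]
  · rw [contract_contract_of_lt h, neg_neg]

theorem contract_wedge_of_lt {a b : ℕ} (h : a < b) (c : Finset ℕ → S) :
    contract a (wedge b c) = -wedge b (contract a c) := by
  ext T
  simp only [contract_apply, wedge_apply, Pi.neg_apply, Finset.mem_insert, Finset.mem_erase]
  by_cases ha : a ∈ T <;> by_cases hb : b ∈ T <;> simp [ha, hb, h.ne, h.ne']
  rw [sign_insert_of_lt h ha, sign_erase_of_le h.le, Finset.erase_insert_of_ne h.ne]
  ring

theorem contract_wedge_self_add (a : ℕ) (c : Finset ℕ → S) :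
    contract a (wedge a c) + wedge a (contract a c) = c := by
  ext T
  simp only [contract_apply, wedge_apply, Pi.add_apply]
  by_cases ha : a ∈ T
  · simp [ha, sign_erase_of_le le_rfl, ← mul_assoc, sign_mul_self]
  · simp [ha, sign_insert_of_le le_rfl, ← mul_assoc, sign_mul_self]

/-- The Koszul differential of `f 0, …, f (r - 1)`. -/
def koszulD (f : ℕ → S) (r : ℕ) : (Finset ℕ → S) →ₗ[S] (Finset ℕ → S) :=
  ∑ a ∈ Finset.range r, f a • contract a

theorem koszulD_zero (f : ℕ → S) (c : Finset ℕ → S) : koszulD f 0 c = 0 := by simp [koszulD]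

theorem koszulD_succ (f : ℕ → S) (r : ℕ) (c : Finset ℕ → S) :
    koszulD f (r + 1) c = koszulD f r c + f r • contract r c := by
  simp [koszulD, Finset.sum_range_succ]

theorem koszulD_apply (f : ℕ → S) (r : ℕ) (c : Finset ℕ → S) (T : Finset ℕ) :
    koszulD f r c T = ∑ a ∈ Finset.range r, f a * contract a c T := by
  simp [koszulD]

theorem contract_koszulD (f : ℕ → S) (r b : ℕ) (c : Finset ℕ → S) :
    contract b (koszulD f r c) = -koszulD f r (contract b c) := by
  induction r with
  | zero => simp [koszulD_zero]
  | succ r ih => rw [koszulD_succ, koszulD_succ, map_add, ih, map_smul, contract_contract]; module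

theorem koszulD_wedge (f : ℕ → S) {r b : ℕ} (h : r ≤ b) (c : Finset ℕ → S) :
    koszulD f r (wedge b c) = -wedge b (koszulD f r c) := by
  induction r with
  | zero => simp [koszulD_zero]
  | succ r ih =>
    rw [koszulD_succ, koszulD_succ, map_add, ih (by omega), map_smul,
      contract_wedge_of_lt (by omega)]
    module

theorem koszulD_koszulD (f : ℕ → S) (r : ℕ) (c : Finset ℕ → S) :
    koszulD f r (koszulD f r c) = 0 := by
  induction r generalizing c with
  | zero => simp [koszulD_zero]
  | succ r ih =>
    rw [koszulD_succ f r (koszulD f (r + 1) c), contract_koszulD, koszulD_succ, koszulD_succ,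
      map_add, map_smul, ih, contract_contract_self]
    module

/-- The cochains of exterior degree `q` on the generators `0, …, r - 1`. -/
def IsCochain (r q : ℕ) (c : Finset ℕ → S) : Prop :=
  ∀ T, ¬ (T ⊆ Finset.range r ∧ T.card = q) → c T = 0

theorem IsCochain.add {r q : ℕ} {c c' : Finset ℕ → S} (h : IsCochain r q c)
    (h' : IsCochain r q c') : IsCochain r q (c + c') := fun T hT => by
  simp [h T hT, h' T hT]

theorem IsCochain.smul {r q : ℕ} {c : Finset ℕ → S} (s : S) (h : IsCochain r q c) :
    IsCochain r q (s • c) := fun T hT => by simp [h T hT]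

theorem IsCochain.sub {r q : ℕ} {c c' : Finset ℕ → S} (h : IsCochain r q c)
    (h' : IsCochain r q c') : IsCochain r q (c - c') := fun T hT => by
  simp [h T hT, h' T hT]

theorem IsCochain.succ {r q : ℕ} {c : Finset ℕ → S} (h : IsCochain r q c) :
    IsCochain (r + 1) q c := fun T hT =>
  h T fun h' => hT ⟨h'.1.trans (Finset.range_mono r.le_succ), h'.2⟩

theorem IsCochain.contract {r q a : ℕ} {c : Finset ℕ → S} (h : IsCochain r (q + 1) c) :
    IsCochain r q (contract a c) := fun T hT => by
  rw [contract_apply]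
  split_ifs with ha
  · rfl
  · rw [h, mul_zero]
    rintro ⟨h1, h2⟩
    rw [Finset.card_insert_of_notMem ha] at h2
    exact hT ⟨(Finset.subset_insert a T).trans h1, by omega⟩

theorem IsCochain.koszulD {f : ℕ → S} {r q s : ℕ} {c : Finset ℕ → S} (h : IsCochain r (q + 1) c) :
    IsCochain r q (koszulD f s c) := fun T hT => by
  rw [koszulD_apply]
  exact Finset.sum_eq_zero fun a _ => by rw [h.contract T hT, mul_zero]

theorem IsCochain.contract_last {r q : ℕ} {c : Finset ℕ → S} (h : IsCochain (r + 1) (q + 1) c) :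
    IsCochain r q (KoszulCochain.contract r c) := fun T hT => by
  by_cases hr : r ∈ T
  · simp [contract_apply, hr]
  · refine h.contract T fun hT' => hT ⟨fun t ht => ?_, hT'.2⟩
    have h1 := Finset.mem_range.1 (hT'.1 ht)
    have h2 : t ≠ r := fun h => hr (h ▸ ht)
    exact Finset.mem_range.2 (by omega)

theorem IsCochain.wedge_last {r q : ℕ} {c : Finset ℕ → S} (h : IsCochain r q c) :
    IsCochain (r + 1) (q + 1) (wedge r c) := fun T hT => by
  rw [wedge_apply]
  split_ifs with hr
  · rw [h, mul_zero]
    rintro ⟨h1, h2⟩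
    rw [Finset.card_erase_of_mem hr] at h2
    have := Finset.card_pos.2 ⟨r, hr⟩
    refine hT ⟨fun t ht => ?_, by omega⟩
    by_cases htr : t = r
    · simp [htr]
    · have := Finset.mem_range.1 (h1 (Finset.mem_erase.2 ⟨htr, ht⟩))
      exact Finset.mem_range.2 (by omega)
  · rfl

theorem IsCochain.contract_eq_zero {r q : ℕ} {c : Finset ℕ → S} (h : IsCochain r q c) :
    KoszulCochain.contract r c = 0 := by
  ext T
  rw [contract_apply]
  split_ifs with hr
  · rfl
  · rw [h, mul_zero, Pi.zero_apply]
    exact fun h' => by simpa using h'.1 (Finset.mem_insert_self r T)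

theorem koszulD_empty (f : ℕ → S) (r : ℕ) (c : Finset ℕ → S) :
    koszulD f r c ∅ = ∑ a ∈ Finset.range r, f a * c {a} := by
  simp [koszulD_apply, contract_apply, sign]

/-- In exterior degree `0`, an element of the ideal `(f 0, …, f (r - 1))` is a boundary. -/
theorem exists_koszulD_eq_of_mem_span {f : ℕ → S} {r : ℕ} {c : Finset ℕ → S} (hc : IsCochain r 0 c)
    (h : c ∅ ∈ Ideal.span (f '' (Finset.range r : Set ℕ))) :
    ∃ e, IsCochain r 1 e ∧ koszulD f r e = c := by
  obtain ⟨g, hg⟩ : ∃ g : ℕ → S, ∑ a ∈ Finset.range r, g a * f a = c ∅ := by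
    obtain ⟨g, hg⟩ := (Submodule.mem_span_image_finset_iff_exists_fun S).1 h
    refine ⟨fun a => if h : a ∈ Finset.range r then g ⟨a, h⟩ else 0, ?_⟩
    rw [← hg, ← Finset.sum_coe_sort]
    exact Finset.sum_congr rfl fun a _ => by
      dsimp only
      rw [dif_pos a.2, smul_eq_mul]
  have he : IsCochain r 1 fun T => ∑ a ∈ Finset.range r, if T = {a} then g a else 0 := by
    intro T hT
    refine Finset.sum_eq_zero fun a ha => if_neg ?_
    rintro rfl
    exact hT ⟨by simpa using ha, by simp⟩
  refine ⟨_, he, ?_⟩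
  ext T
  by_cases hT : T = ∅
  · subst hT
    rw [koszulD_empty, ← hg]
    refine Finset.sum_congr rfl fun a ha => ?_
    have : (∑ b ∈ Finset.range r, if ({a} : Finset ℕ) = {b} then g b else 0) = g a := by
      simp only [Finset.singleton_inj]
      rw [Finset.sum_ite_eq, if_pos ha]
    rw [this, mul_comm]
  · have h1 : ¬ (T ⊆ Finset.range r ∧ T.card = 0) := fun h => hT (Finset.card_eq_zero.1 h.2)
    rw [hc T h1, he.koszulD T h1]

/-- The Koszul complex of a weakly regular sequence is exact in positive degrees. Induction on the
length: the part of a cycle that contains the last generator is itself a cycle for the shorter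
sequence, and after subtracting a boundary it may be assumed to be zero. -/
theorem exists_koszulD_eq {f : ℕ → S} {r : ℕ}
    (hf : ∀ i < r, ∀ p, f i * p ∈ Ideal.span (f '' (Finset.range i : Set ℕ)) →
      p ∈ Ideal.span (f '' (Finset.range i : Set ℕ)))
    {q : ℕ} {c : Finset ℕ → S} (hc : IsCochain r (q + 1) c) (hd : koszulD f r c = 0) :
    ∃ e, IsCochain r (q + 2) e ∧ koszulD f r e = c := by
  induction r generalizing q c with
  | zero =>
    refine ⟨0, fun T _ => rfl, ?_⟩
    ext T
    rw [map_zero, Pi.zero_apply, hc]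
    rintro ⟨h1, h2⟩
    have : T = ∅ := by simpa using h1
    simp [this] at h2
  | succ r ih =>
    replace ih := @ih fun i hi => hf i (by omega)
    have hb : IsCochain r q (contract r c) := hc.contract_last
    have hdc : koszulD f r c = -(f r • contract r c) := by
      rw [koszulD_succ] at hd
      exact eq_neg_of_add_eq_zero_left hd
    have hdb : koszulD f r (contract r c) = 0 := by
      rw [← neg_eq_zero, ← contract_koszulD, hdc, map_neg, map_smul, contract_contract_self,
        smul_zero, neg_zero]
    -- the part of `c` containing the last generator is a boundary
    obtain ⟨e, he, hde⟩ : ∃ e, IsCochain r (q + 1) e ∧ koszulD f r e = contract r c := by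
      cases q with
      | succ q => exact ih hb hdb
      | zero =>
        refine exists_koszulD_eq_of_mem_span hb (hf r (by omega) _ ?_)
        have h0 := congrFun hdc ∅
        rw [koszulD_empty, Pi.neg_apply, Pi.smul_apply, smul_eq_mul] at h0
        rw [← neg_mem_iff, ← h0]
        exact Ideal.sum_mem _ fun a ha =>
          Ideal.mul_mem_right _ _ (Ideal.subset_span ⟨a, by simpa using ha, rfl⟩)
    have hse : contract r (wedge r e) = e := by
      have := contract_wedge_self_add r e
      rwa [he.contract_eq_zero, map_zero, add_zero] at this
    have hc1 : c + koszulD f (r + 1) (wedge r e) = contract r (wedge r c) + f r • e := by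
      rw [koszulD_succ, koszulD_wedge f le_rfl, hde, hse]
      nth_rewrite 1 [← contract_wedge_self_add r c]
      module
    -- what remains is a cycle that does not contain the last generator
    obtain ⟨e1, he1, hde1⟩ : ∃ e1, IsCochain r (q + 2) e1 ∧
        koszulD f r e1 = contract r (wedge r c) + f r • e := by
      refine ih (IsCochain.add (fun T hT => ?_) (he.smul _)) ?_
      · have hcw : contract r (wedge r c) T = if r ∈ T then 0 else c T := by
          by_cases hr : r ∈ T <;>
            simp [contract_apply, wedge_apply, hr, sign_insert_of_le le_rfl, ← mul_assoc,
              sign_mul_self]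
        rw [hcw]
        split_ifs with hr
        · rfl
        · refine hc T fun hT' => hT ⟨fun t ht => ?_, hT'.2⟩
          have h1 := Finset.mem_range.1 (hT'.1 ht)
          have h2 : t ≠ r := fun h => hr (h ▸ ht)
          exact Finset.mem_range.2 (by omega)
      · have h1 : koszulD f (r + 1) (contract r (wedge r c) + f r • e) = 0 := by
          rw [← hc1, map_add, koszulD_koszulD, hd, add_zero]
        rw [koszulD_succ, map_add (contract r), map_smul, contract_contract_self,
          he.contract_eq_zero, smul_zero, add_zero, smul_zero, add_zero] at h1
        exact h1
    refine ⟨e1 - wedge r e, he1.succ.sub he.wedge_last, ?_⟩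
    rw [map_sub, koszulD_succ f r e1, he1.contract_eq_zero, hde1, smul_zero, add_zero, ← hc1]
    abel

end KoszulCochain

/-! ### Reduction of the Koszul complex modulo a second sequence -/

namespace KoszulCochain

variable {S : Type*} [CommRing S]

/-- The ideal `(x 0, …, x (i - 1))`. -/
def initialIdeal (x : ℕ → S) (i : ℕ) : Ideal S := Ideal.span (x '' (Finset.range i : Set ℕ))

/-- `x 0, …, x (k - 1)` is a weakly regular sequence: each member is a nonzerodivisor modulo the
preceding ones. -/
def IsInitiallyRegular (x : ℕ → S) (k : ℕ) : Prop :=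
  ∀ i < k, ∀ p, x i * p ∈ initialIdeal x i → p ∈ initialIdeal x i

theorem initialIdeal_zero (x : ℕ → S) : initialIdeal x 0 = ⊥ := by simp [initialIdeal]

theorem initialIdeal_succ (x : ℕ → S) (i : ℕ) :
    initialIdeal x (i + 1) = Ideal.span {x i} ⊔ initialIdeal x i := by
  rw [initialIdeal, Finset.range_add_one, Finset.coe_insert, Set.image_insert_eq, Ideal.span_insert]
  rfl

theorem initialIdeal_le_succ (x : ℕ → S) (i : ℕ) : initialIdeal x i ≤ initialIdeal x (i + 1) :=
  initialIdeal_succ x i ▸ le_sup_right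

theorem mem_initialIdeal {x : ℕ → S} {i l : ℕ} (h : l < i) : x l ∈ initialIdeal x i :=
  Ideal.subset_span ⟨l, by simpa using h, rfl⟩

theorem koszulD_mem {f : ℕ → S} {r : ℕ} {J : Ideal S} {c : Finset ℕ → S} (h : ∀ T, c T ∈ J)
    (T : Finset ℕ) : koszulD f r c T ∈ J := by
  rw [koszulD_apply]
  refine J.sum_mem fun a _ => J.mul_mem_left _ ?_
  rw [contract_apply]
  split_ifs
  · exact J.zero_mem
  · exact J.mul_mem_left _ (h _)

theorem IsCochain.koszulD_eq_zero {f : ℕ → S} {r s : ℕ} {c : Finset ℕ → S} (h : IsCochain r 0 c) :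
    KoszulCochain.koszulD f s c = 0 := by
  ext T
  rw [koszulD_apply]
  refine Finset.sum_eq_zero fun a _ => ?_
  rw [contract_apply]
  split_ifs with ha
  · exact mul_zero _
  · rw [h, mul_zero, mul_zero]
    simp

/-- A cochain with coefficients in `(x 0, …, x i)` is a multiple of `x i` modulo
`(x 0, …, x (i - 1))`. -/
theorem IsCochain.exists_sub_smul_mem {x : ℕ → S} {r q i : ℕ} {c : Finset ℕ → S}
    (hc : IsCochain r q c) (h : ∀ T, c T ∈ initialIdeal x (i + 1)) :
    ∃ c' : Finset ℕ → S, IsCochain r q c' ∧ ∀ T, (c - x i • c') T ∈ initialIdeal x i := by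
  have h1 : ∀ T, ∃ p, c T - x i * p ∈ initialIdeal x i := by
    intro T
    have := h T
    rw [initialIdeal_succ, Ideal.mem_span_singleton_sup] at this
    obtain ⟨p, y, hy, hp⟩ := this
    exact ⟨p, by rw [← hp]; convert hy using 1; ring⟩
  choose p hp using h1
  classical
  refine ⟨fun T => if T ⊆ Finset.range r ∧ T.card = q then p T else 0,
    fun T hT => if_neg hT, fun T => ?_⟩
  by_cases hT : T ⊆ Finset.range r ∧ T.card = q
  · simpa [hT] using hp T
  · simp [hT, hc T hT]

/-- Modulo `i` elements of a regular sequence, the Koszul complex of a regular sequence remains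
exact in degrees above `i`: each reduction raises the degree of the possible homology by one. -/
theorem exists_koszulD_sub_mem {f x : ℕ → S} {r k : ℕ} (hf : IsInitiallyRegular f r)
    (hx : IsInitiallyRegular x k) {i : ℕ} (hi : i ≤ k) {q : ℕ} (hq : i ≤ q) {c : Finset ℕ → S}
    (hc : IsCochain r (q + 1) c) (hd : ∀ T, koszulD f r c T ∈ initialIdeal x i) :
    ∃ e, IsCochain r (q + 2) e ∧ ∀ T, (c - koszulD f r e) T ∈ initialIdeal x i := by
  induction i generalizing q c with
  | zero =>
    obtain ⟨e, he, hde⟩ := exists_koszulD_eq hf hc (by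
      ext T
      simpa [initialIdeal_zero] using hd T)
    exact ⟨e, he, fun T => by simp [hde]⟩
  | succ i ih =>
    obtain ⟨q, rfl⟩ : ∃ q', q = q' + 1 := ⟨q - 1, by omega⟩
    obtain ⟨c', hc', hcc'⟩ := hc.koszulD.exists_sub_smul_mem hd
    have hd' : ∀ T, koszulD f r c' T ∈ initialIdeal x i := by
      intro T
      refine hx i (by omega) _ ?_
      have := koszulD_mem (f := f) (r := r) hcc' T
      rw [map_sub, koszulD_koszulD, zero_sub, map_smul] at this
      simpa using this
    obtain ⟨h, hh, hch⟩ := ih (by omega) (by omega : i ≤ q) hc' hd'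
    obtain ⟨e, he, hce⟩ := ih (by omega) (by omega : i ≤ q + 1) (hc.sub (hh.smul (x i))) (by
      intro T
      have h1 := hcc' T
      have h2 := (initialIdeal x i).mul_mem_left (x i) (hch T)
      convert add_mem h1 h2 using 1
      simp only [map_sub, map_smul, Pi.sub_apply, Pi.smul_apply, smul_eq_mul]
      ring)
    refine ⟨e, he, fun T => ?_⟩
    have h1 := initialIdeal_le_succ x i (hce T)
    have h2 := (initialIdeal x (i + 1)).mul_mem_right (h T) (mem_initialIdeal i.lt_succ_self)
    convert add_mem h1 h2 using 1
    simp only [Pi.sub_apply, Pi.smul_apply, smul_eq_mul]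
    ring

/-- `IsLift f x r i z c` says that `c` is obtained from `z` by `i` steps, each of which
divides `x j • c` by the differential modulo `(x 0, …, x (j - 1))`: on homology, a step inverts the
connecting homomorphism of multiplication by `x j`. -/
def IsLift (f x : ℕ → S) (r : ℕ) : ℕ → S → (Finset ℕ → S) → Prop
  | 0, z, c => IsCochain r 0 c ∧ c ∅ = z
  | i + 1, z, e => IsCochain r (i + 1) e ∧
      ∃ c, IsLift f x r i z c ∧ ∀ T, (x i • c - koszulD f r e) T ∈ initialIdeal x i

theorem IsLift.isCochain {f x : ℕ → S} {r i : ℕ} {z : S} {c : Finset ℕ → S}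
    (h : IsLift f x r i z c) : IsCochain r i c := by
  cases i <;> exact h.1

theorem IsLift.koszulD_mem {f x : ℕ → S} {r i : ℕ} {z : S} {c : Finset ℕ → S}
    (h : IsLift f x r i z c) (T : Finset ℕ) : koszulD f r c T ∈ initialIdeal x i := by
  cases i with
  | zero => simp [h.isCochain.koszulD_eq_zero]
  | succ i =>
    obtain ⟨_, c', _, hc⟩ := h
    have h1 := initialIdeal_le_succ x i (hc T)
    have h2 := (initialIdeal x (i + 1)).mul_mem_right (c' T) (mem_initialIdeal i.lt_succ_self)
    convert sub_mem h2 h1 using 1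
    simp

theorem IsLift.smul_add_smul {f x : ℕ → S} {r i : ℕ} {z z' : S} {c c' : Finset ℕ → S} (s s' : S)
    (h : IsLift f x r i z c) (h' : IsLift f x r i z' c') :
    IsLift f x r i (s * z + s' * z') (s • c + s' • c') := by
  induction i generalizing c c' with
  | zero => exact ⟨(h.1.smul s).add (h'.1.smul s'), by simp [h.2, h'.2]⟩
  | succ i ih =>
    obtain ⟨h1, d, hd, h2⟩ := h
    obtain ⟨h1', d', hd', h2'⟩ := h'
    refine ⟨(h1.smul s).add (h1'.smul s'), _, ih hd hd', fun T => ?_⟩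
    convert add_mem ((initialIdeal x i).mul_mem_left s (h2 T))
      ((initialIdeal x i).mul_mem_left s' (h2' T)) using 1
    simp only [map_add, map_smul, Pi.sub_apply, Pi.add_apply, Pi.smul_apply, smul_eq_mul]
    ring

/-- Lifting is injective on homology. This needs regularity of `x` only. -/
theorem IsLift.mem_initialIdeal_of_boundary {f x : ℕ → S} {r k i : ℕ}
    (hx : IsInitiallyRegular x k) (hi : i ≤ k) {z : S} {c e : Finset ℕ → S}
    (h : IsLift f x r i z c) (he : IsCochain r (i + 1) e)
    (hce : ∀ T, (c - koszulD f r e) T ∈ initialIdeal x i) : z ∈ initialIdeal f r := by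
  induction i generalizing c e with
  | zero =>
    have := hce ∅
    rw [initialIdeal_zero, Ideal.mem_bot, Pi.sub_apply, h.2, koszulD_empty, sub_eq_zero] at this
    rw [this]
    exact Ideal.sum_mem _ fun a ha =>
      Ideal.mul_mem_right _ _ (mem_initialIdeal (Finset.mem_range.1 ha))
  | succ i ih =>
    obtain ⟨hc, d, hd, hdc⟩ := h
    obtain ⟨g, hg, hcg⟩ := (hc.sub he.koszulD).exists_sub_smul_mem hce
    refine ih (by omega) hd hg fun T => hx i (by omega) _ ?_
    have := KoszulCochain.koszulD_mem (f := f) (r := r) hcg T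
    convert add_mem (hdc T) this using 1
    simp only [map_sub, map_smul, koszulD_koszulD, Pi.sub_apply, Pi.smul_apply, smul_eq_mul,
      Pi.zero_apply]
    ring

/-- An element annihilated by all `x l` modulo `(f 0, …, f (r - 1))` can be lifted
`k` times. The induction carries along that the lifts are annihilated by all `x l` on homology. -/
theorem exists_isLift {f x : ℕ → S} {r k : ℕ} (hf : IsInitiallyRegular f r)
    (hx : IsInitiallyRegular x k) {z : S} (hz : ∀ l < k, x l * z ∈ initialIdeal f r) {i : ℕ}
    (hi : i ≤ k) :
    ∃ c, IsLift f x r i z c ∧ ∀ l < k, ∃ g, IsCochain r (i + 1) g ∧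
      ∀ T, (x l • c - koszulD f r g) T ∈ initialIdeal x i := by
  induction i with
  | zero =>
    obtain ⟨c, h0, hcz⟩ : ∃ c : Finset ℕ → S, IsCochain r 0 c ∧ c ∅ = z :=
      ⟨fun T => if T = ∅ then z else 0, fun T hT => if_neg fun h => hT (by simp [h]), if_pos rfl⟩
    refine ⟨c, ⟨h0, hcz⟩, fun l hl => ?_⟩
    obtain ⟨e, he, hde⟩ := exists_koszulD_eq_of_mem_span (f := f) (h0.smul (x l)) (by
      rw [Pi.smul_apply, hcz]
      exact hz l hl)
    exact ⟨e, he, fun T => by rw [hde, sub_self]; exact Ideal.zero_mem _⟩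
  | succ i ih =>
    obtain ⟨c, hc, hcl⟩ := ih (by omega)
    obtain ⟨e, he, hce⟩ := hcl i (by omega)
    refine ⟨e, ⟨he, c, hc, hce⟩, fun l hl => ?_⟩
    obtain ⟨g, hg, hcg⟩ := hcl l hl
    obtain ⟨u, hu, hgu⟩ := exists_koszulD_sub_mem hf hx (by omega) le_rfl
      ((he.smul (x l)).sub (hg.smul (x i))) (fun T => by
        convert sub_mem ((initialIdeal x i).mul_mem_left (x i) (hcg T))
          ((initialIdeal x i).mul_mem_left (x l) (hce T)) using 1
        simp only [map_sub, map_smul, Pi.sub_apply, Pi.smul_apply, smul_eq_mul]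
        ring)
    refine ⟨u, hu, fun T => ?_⟩
    have h1 := initialIdeal_le_succ x i (hgu T)
    have h2 := (initialIdeal x (i + 1)).mul_mem_right (g T) (mem_initialIdeal i.lt_succ_self)
    convert add_mem h1 h2 using 1
    simp only [Pi.sub_apply, Pi.smul_apply, smul_eq_mul]
    ring

end KoszulCochain

/-! ### Regular sequences and height -/

namespace KoszulCochain

/-- A weakly regular sequence of length `r` generates an ideal of height at least `r`, since each
member avoids the minimal primes of the preceding ones. -/
theorem le_height_initialIdeal {S : Type*} [CommRing S] {f : ℕ → S} {r : ℕ}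
    (hf : IsInitiallyRegular f r) : (r : ℕ∞) ≤ (initialIdeal f r).height := by
  induction r with
  | zero => simp
  | succ r ih =>
    rw [Ideal.height_eq_inf_minimalPrimes]
    refine le_iInf₂ fun P hP => ?_
    have hPp : P.IsPrime := hP.1.1
    have hle : initialIdeal f r ≤ P := (initialIdeal_le_succ f r).trans hP.1.2
    obtain ⟨Q, hQ, hQP⟩ := Ideal.exists_minimalPrimes_le hle
    have hQp : Q.IsPrime := hQ.1.1
    have hlt : Q < P := by
      refine lt_of_le_of_ne hQP fun h => ?_
      have hfr : f r ∈ Q := h ▸ hP.1.2 (mem_initialIdeal r.lt_succ_self)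
      obtain ⟨y, hy, hxy⟩ := Ideal.exists_mul_mem_of_mem_minimalPrimes hQ hfr
      exact hy (hf r (by omega) _ hxy)
    have h1 := ih fun i hi => hf i (by omega)
    rw [Nat.cast_add, Nat.cast_one]
    calc (r : ℕ∞) + 1 ≤ Q.height + 1 := by gcongr; exact h1.trans (Ideal.height_mono hQ.1.2)
      _ ≤ P.height := Ideal.height_add_one_le_of_lt_of_isPrime hlt

/-- A finite family, continued by `0` to all of `ℕ`. -/
def extendByZero {S : Type*} [Zero S] {m : ℕ} (f : Fin m → S) (a : ℕ) : S :=
  if h : a < m then f ⟨a, h⟩ else 0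

theorem extendByZero_of_lt {S : Type*} [Zero S] {m : ℕ} (f : Fin m → S) {a : ℕ} (h : a < m) :
    extendByZero f a = f ⟨a, h⟩ := dif_pos h

theorem initialIdeal_extendByZero {S : Type*} [CommRing S] {m : ℕ} (f : Fin m → S) :
    initialIdeal (extendByZero f) m = Ideal.span (Set.range f) := by
  rw [initialIdeal]
  congr 1
  ext p
  constructor
  · rintro ⟨a, ha, rfl⟩
    have ha' : a < m := by simpa using ha
    exact ⟨⟨a, ha'⟩, (extendByZero_of_lt f ha').symm⟩
  · rintro ⟨a, rfl⟩
    exact ⟨a, by simp, extendByZero_of_lt f a.2⟩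

theorem isInitiallyRegular_extendByZero {S : Type*} [CommRing S] {m : ℕ} {f : Fin m → S}
    (hf : RingTheory.Sequence.IsWeaklyRegular S (List.ofFn f)) :
    IsInitiallyRegular (extendByZero f) m := by
  intro i hi p hp
  have h := hf.regular_mod_prev i (by simpa using hi)
  have hJ : Ideal.ofList ((List.ofFn f).take i) • (⊤ : Submodule S S) =
      initialIdeal (extendByZero f) i := by
    rw [smul_eq_mul, Ideal.mul_top, initialIdeal, Ideal.ofList]
    congr 1
    ext q
    simp only [Set.mem_ofPred_eq, List.mem_take_iff_getElem, Set.mem_image]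
    constructor
    · rintro ⟨a, ha, rfl⟩
      have ha' : a < i ∧ a < m := by simpa using ha
      exact ⟨a, by simpa using ha'.1, by rw [extendByZero_of_lt f ha'.2]; simp⟩
    · rintro ⟨a, ha, rfl⟩
      have ha' : a < i := by simpa using ha
      exact ⟨a, by simp; omega, by rw [extendByZero_of_lt f (by omega)]; simp⟩
  rw [hJ] at h
  have hfi : (List.ofFn f)[i]'(by simpa using hi) = extendByZero f i := by
    rw [extendByZero_of_lt f hi]; simp
  rw [hfi] at h
  have h0 : extendByZero f i • (Submodule.Quotient.mk p : S ⧸ initialIdeal (extendByZero f) i) =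
      extendByZero f i • 0 := by
    rw [smul_zero, ← Submodule.Quotient.mk_smul, Submodule.Quotient.mk_eq_zero]
    exact hp
  exact (Submodule.Quotient.mk_eq_zero _).1 (h h0)

end KoszulCochain

namespace MvPolynomial

variable {K σ : Type*} [Field K]

/-- Linearly independent linear forms are a regular sequence: after a linear change of variables
they are variables. -/
theorem isInitiallyRegular_of_linearIndependent [Finite σ] {k : ℕ} {x : ℕ → MvPolynomial σ K}
    (hx : ∀ i < k, (x i).IsHomogeneous 1)
    (hli : LinearIndependent K fun i : Fin k => x i) : KoszulCochain.IsInitiallyRegular x k := by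
  have := Fintype.ofFinite σ
  classical
  let L : (σ → K) →ₗ[K] MvPolynomial σ K := Fintype.linearCombination K X
  have hL : ∀ i : Fin k, ∃ v, L v = x i := by
    intro i
    have h := (mem_homogeneousSubmodule 1 _).2 (hx i i.2)
    rw [homogeneousSubmodule_one_eq_span_X, ← Fintype.range_linearCombination] at h
    exact h
  choose v hv using hL
  have hvli : LinearIndependent K v := by
    refine LinearIndependent.of_comp L ?_
    convert hli using 1
    ext1 i
    exact hv i
  -- complete the forms to a basis of all linear forms, and let `φ` send the variables to it
  let b := Module.Basis.sumExtend hvli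
  have hb : ∀ i, b (Sum.inl i) = v i := by
    intro i
    simp [b, Module.Basis.sumExtend]
    rfl
  have := Module.Finite.finite_basis b
  have e : Fin k ⊕ Module.Basis.sumExtendIndex hvli ≃ σ := by
    have := Fintype.ofFinite (Fin k ⊕ Module.Basis.sumExtendIndex hvli)
    refine Fintype.equivOfCardEq ?_
    rw [← Module.finrank_eq_card_basis b, Module.finrank_fintype_fun_eq_card]
  let φ : MvPolynomial σ K →ₐ[K] MvPolynomial σ K := aeval fun s => L (b (e.symm s))
  have hφx : ∀ i : Fin k, φ (X (e (Sum.inl i))) = x i := by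
    intro i
    simp [φ, hb, hv]
  have hsurj : Function.Surjective φ := by
    rw [← AlgHom.range_eq_top, ← top_le_iff, ← adjoin_range_X, Algebra.adjoin_le_iff]
    rintro _ ⟨s, rfl⟩
    have hs : L (Pi.single s 1) = X s := by simp [L]
    have hsub : LinearMap.range L ≤ Subalgebra.toSubmodule φ.range := by
      rw [LinearMap.range_eq_map, ← b.span_eq, Submodule.map_span, Submodule.span_le]
      rintro _ ⟨_, ⟨j, rfl⟩, rfl⟩
      exact ⟨X (e j), by simp [φ]⟩
    exact hsub ⟨_, hs⟩
  have hinj : Function.Injective φ := by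
    let M : (σ → K) →ₗ[K] MvPolynomial σ K := b.constr K fun j => X (e j)
    let ψ : MvPolynomial σ K →ₐ[K] MvPolynomial σ K := aeval fun s => M (Pi.single s 1)
    have hψL : ψ.toLinearMap ∘ₗ L = M := by
      refine LinearMap.pi_ext' fun s => LinearMap.ext_ring ?_
      simp [ψ, L]
    have hψφ : ψ.comp φ = AlgHom.id K _ := by
      refine algHom_ext fun s => ?_
      obtain ⟨j, rfl⟩ := e.surjective s
      have h := LinearMap.congr_fun hψL (b j)
      simpa [φ, M] using h
    exact Function.LeftInverse.injective (g := ψ) fun p => AlgHom.congr_fun hψφ p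
  -- under `φ` the claim becomes one about ideals generated by variables
  intro i hi p hp
  let s : Set σ := (fun j : Fin k => e (Sum.inl j)) '' {j | j.1 < i}
  have himg : KoszulCochain.initialIdeal x i = (Ideal.span (X '' s)).map φ := by
    rw [Ideal.map_span, KoszulCochain.initialIdeal]
    congr 1
    ext q
    simp only [s, Set.image_image, hφx]
    constructor
    · rintro ⟨a, ha, rfl⟩
      have ha' : a < i := by simpa using ha
      exact ⟨⟨a, by omega⟩, ha', rfl⟩
    · rintro ⟨a, ha, rfl⟩
      exact ⟨a, by simpa using ha, rfl⟩
  have hmem : ∀ q, φ q ∈ KoszulCochain.initialIdeal x i ↔ q ∈ Ideal.span (X '' s) := by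
    intro q
    rw [himg, ← Ideal.mem_comap, Ideal.comap_map_of_bijective φ ⟨hinj, hsurj⟩]
  obtain ⟨q, rfl⟩ := hsurj p
  rw [← hφx ⟨i, hi⟩, ← map_mul, hmem, mem_ideal_span_X_image] at hp
  rw [hmem, mem_ideal_span_X_image]
  intro m hm
  obtain ⟨j, hj, hjm⟩ := hp (Finsupp.single (e (Sum.inl ⟨i, hi⟩)) 1 + m) (by
    rw [mem_support_iff, add_comm, mul_comm, coeff_mul_X]
    exact mem_support_iff.1 hm)
  refine ⟨j, hj, ?_⟩
  obtain ⟨a, ha, rfl⟩ := hj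
  have hne : e (Sum.inl ⟨i, hi⟩) ≠ e (Sum.inl a) := by
    intro h
    have := Sum.inl.inj (e.injective h)
    rw [← this] at ha
    exact lt_irrefl i ha
  simpa [Finsupp.single_apply, hne] using hjm

end MvPolynomial

/-! ### Koszul complexes of quadrics modulo linear forms -/

namespace MvPolynomial

variable {K σ : Type*} [Field K]

/-- The homogeneous component in an integral degree, zero if the degree is negative. -/
def intComponent (t : ℤ) : MvPolynomial σ K →ₗ[K] MvPolynomial σ K :=
  if 0 ≤ t then homogeneousComponent t.toNat else 0

theorem intComponent_natCast (m : ℕ) (p : MvPolynomial σ K) :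
    intComponent (m : ℤ) p = homogeneousComponent m p := by
  rw [intComponent, if_pos (by omega), Int.toNat_natCast]

theorem intComponent_of_neg {t : ℤ} (ht : t < 0) (p : MvPolynomial σ K) :
    intComponent t p = 0 := by
  rw [intComponent, if_neg (by omega), LinearMap.zero_apply]

theorem intComponent_of_isHomogeneous {m : ℕ} {p : MvPolynomial σ K} (hp : p.IsHomogeneous m)
    (t : ℤ) : intComponent t p = if t = m then p else 0 := by
  rcases lt_or_ge t 0 with ht | ht
  · rw [intComponent_of_neg ht, if_neg (by omega)]
  · obtain ⟨t, rfl⟩ := Int.eq_ofNat_of_zero_le ht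
    simp [intComponent_natCast, homogeneousComponent_of_mem hp]

theorem intComponent_mul {e : ℕ} {g : MvPolynomial σ K} (hg : g.IsHomogeneous e) (t : ℤ)
    (p : MvPolynomial σ K) : intComponent (t + e) (g * p) = g * intComponent t p := by
  rw [← sum_homogeneousComponent p, Finset.mul_sum, map_sum, map_sum, Finset.mul_sum]
  refine Finset.sum_congr rfl fun m _ => ?_
  have h := homogeneousComponent_isHomogeneous m p
  rw [intComponent_of_isHomogeneous (hg.mul h), intComponent_of_isHomogeneous h]
  push_cast
  by_cases ht : t = m
  · rw [if_pos ht, if_pos (by omega)]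
  · rw [if_neg ht, if_neg (by omega), mul_zero]

open KoszulCochain

theorem intComponent_mem_initialIdeal {x : ℕ → MvPolynomial σ K} {i e : ℕ}
    (hx : ∀ l < i, (x l).IsHomogeneous e) {p : MvPolynomial σ K} (hp : p ∈ initialIdeal x i)
    (t : ℤ) : intComponent t p ∈ initialIdeal x i := by
  obtain ⟨g, hg⟩ := (Submodule.mem_span_image_finset_iff_exists_fun _).1 hp
  rw [← hg, map_sum]
  refine Ideal.sum_mem _ fun l _ => ?_
  have hl := Finset.mem_range.1 l.2
  rw [smul_eq_mul, mul_comm, ← sub_add_cancel t (e : ℤ), intComponent_mul (hx l hl)]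
  exact Ideal.mul_mem_right _ _ (mem_initialIdeal hl)

/-- The homogeneous components of the coefficients of a cochain. -/
def cochainComponent (t : ℤ) (c : Finset ℕ → MvPolynomial σ K) : Finset ℕ → MvPolynomial σ K :=
  fun T => intComponent t (c T)

theorem koszulD_cochainComponent {f : ℕ → MvPolynomial σ K} {r e : ℕ}
    (hf : ∀ a < r, (f a).IsHomogeneous e) (t : ℤ) (c : Finset ℕ → MvPolynomial σ K) :
    koszulD f r (cochainComponent t c) = cochainComponent (t + e) (koszulD f r c) := by
  ext1 T
  rw [koszulD_apply, cochainComponent, koszulD_apply, map_sum]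
  refine Finset.sum_congr rfl fun a ha => ?_
  rw [intComponent_mul (hf a (Finset.mem_range.1 ha)), contract_apply, contract_apply]
  congr 1
  split_ifs
  · exact (map_zero _).symm
  · rw [sign]
    rcases neg_one_pow_eq_or (MvPolynomial σ K) (T.filter (· < a)).card with h | h <;>
      simp [h, cochainComponent]

theorem isCochain_cochainComponent {r q : ℕ} {c : Finset ℕ → MvPolynomial σ K}
    (hc : IsCochain r q c) (t : ℤ) : IsCochain r q (cochainComponent t c) := fun T hT => by
  rw [cochainComponent, hc T hT, map_zero]

/-- Each lifting step of linear forms through a Koszul complex of quadrics lowers the polynomial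
degree by one. -/
theorem isLift_cochainComponent {f x : ℕ → MvPolynomial σ K} {r i m : ℕ}
    (hf : ∀ a < r, (f a).IsHomogeneous 2) (hx : ∀ l < i, (x l).IsHomogeneous 1)
    {z : MvPolynomial σ K} (hz : z.IsHomogeneous m) {c : Finset ℕ → MvPolynomial σ K}
    (h : IsLift f x r i z c) : IsLift f x r i z (cochainComponent ((m : ℤ) - i) c) := by
  induction i generalizing c with
  | zero =>
    refine ⟨isCochain_cochainComponent h.1 _, ?_⟩
    rw [cochainComponent, h.2, intComponent_of_isHomogeneous hz, if_pos (by simp)]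
  | succ i ih =>
    obtain ⟨hc, d, hd, hdc⟩ := h
    refine ⟨isCochain_cochainComponent hc _, _, ih (fun l hl => hx l (by omega)) hd, fun T => ?_⟩
    have h1 := intComponent_mem_initialIdeal (fun l hl => hx l (by omega)) (hdc T)
      ((m : ℤ) - i + (1 : ℕ))
    rw [Pi.sub_apply, Pi.smul_apply, smul_eq_mul, map_sub, intComponent_mul (hx i (by omega))] at h1
    rw [koszulD_cochainComponent hf]
    convert h1 using 1
    rw [Pi.sub_apply, Pi.smul_apply, smul_eq_mul, cochainComponent, cochainComponent]
    congr 3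
    push_cast
    ring

/-- Modulo a regular sequence of quadrics, a form of degree less than `k` that is annihilated by
`k` independent linear forms vanishes. -/
theorem mem_initialIdeal_of_forall_mul_mem {f x : ℕ → MvPolynomial σ K} {r k : ℕ}
    (hf : IsInitiallyRegular f r) (hx : IsInitiallyRegular x k)
    (hfh : ∀ a < r, (f a).IsHomogeneous 2) (hxh : ∀ l < k, (x l).IsHomogeneous 1)
    {j : ℕ} (hj : j < k) {z : MvPolynomial σ K} (hz : z.IsHomogeneous j)
    (hxz : ∀ l < k, x l * z ∈ initialIdeal f r) :
    z ∈ initialIdeal f r := by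
  obtain ⟨c, hc, _⟩ := exists_isLift hf hx hxz le_rfl
  have h := isLift_cochainComponent hfh hxh hz hc
  refine h.mem_initialIdeal_of_boundary hx le_rfl (e := 0) (fun _ _ => rfl) fun T => ?_
  rw [map_zero, sub_zero, cochainComponent, intComponent_of_neg (by omega)]
  exact Ideal.zero_mem _

/-- A constant Koszul cochain of degree `k` whose differential vanishes modulo an ideal is zero if
it vanishes at `r \ B`, where the `f b`, `b ∈ B`, are linearly independent modulo the ideal and all
but at most `k` of the generators. The values at sets that meet `B` are determined by the values at
sets that meet `B` less. -/
theorem constant_cochain_eq_zero {f : ℕ → MvPolynomial σ K} {r k : ℕ}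
    {J : Ideal (MvPolynomial σ K)} {B : Finset ℕ} (hB : B ⊆ Finset.range r) (hBk : r ≤ k + B.card)
    (hli : LinearIndepOn K (fun a => Ideal.Quotient.mkₐ K J (f a)) (B : Set ℕ))
    {γ : Finset ℕ → K} (hγ : IsCochain r k γ)
    (hd : ∀ T, koszulD f r (fun T => C (γ T)) T ∈ J) (h0 : γ (Finset.range r \ B) = 0) :
    γ = 0 := by
  have key : ∀ m U, (U ∩ B).card = m → γ U = 0 := by
    intro m
    induction m with
    | zero =>
      intro U hU
      by_cases hUk : U ⊆ Finset.range r ∧ U.card = k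
      · have hsub : U ⊆ Finset.range r \ B := fun t ht => by
          refine Finset.mem_sdiff.2 ⟨hUk.1 ht, fun htB => ?_⟩
          exact Finset.notMem_empty t (Finset.card_eq_zero.1 hU ▸ Finset.mem_inter.2 ⟨ht, htB⟩)
        have hcard := Finset.card_sdiff_of_subset hB
        rw [Finset.card_range] at hcard
        rw [Finset.eq_of_subset_of_card_le hsub (by omega), h0]
      · exact hγ U hUk
    | succ m ih =>
      intro U hU
      obtain ⟨b, hb⟩ := Finset.card_pos.1 (by omega : 0 < (U ∩ B).card)
      obtain ⟨hbU, hbB⟩ := Finset.mem_inter.1 hb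
      -- the coefficient of the differential at `U \ {b}` involves only the generators in `B`
      have hdT := hd (U.erase b)
      have hterm : ∀ a, f a * contract a (fun T => C (γ T)) (U.erase b) =
          (if a ∈ U.erase b then 0 else
            sign K a (U.erase b) * γ (insert a (U.erase b))) • f a := by
        intro a
        rw [contract_apply]
        split_ifs
        · simp
        · rw [smul_eq_C_mul, C_mul, mul_comm, sign, sign, map_pow, map_neg, C_1]
      rw [koszulD_apply, Finset.sum_congr rfl fun a _ => hterm a,
        ← Finset.sum_subset hB] at hdT
      · rw [← Ideal.Quotient.eq_zero_iff_mem, ← Ideal.Quotient.mkₐ_eq_mk K, map_sum] at hdT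
        simp only [map_smul] at hdT
        have h1 := linearIndepOn_finset_iff.1 hli _ hdT b hbB
        rw [if_neg (Finset.notMem_erase b U), Finset.insert_erase hbU] at h1
        refine (mul_eq_zero.1 h1).resolve_left ?_
        rw [sign]
        exact pow_ne_zero _ (by simp)
      · intro a _ haB
        split_ifs
        · exact zero_smul _ _
        · rw [ih, mul_zero, zero_smul]
          rw [Finset.insert_inter_of_notMem haB, Finset.erase_inter,
            Finset.card_erase_of_mem hb, hU]
          rfl
  ext U
  exact key _ U rfl

/-- Modulo `k` linear forms, a regular sequence of `r` forms of positive degree contains at least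
`r - k` linearly independent ones, by Krull's height theorem. -/
theorem exists_linearIndepOn_mkₐ [Finite σ] {f x : ℕ → MvPolynomial σ K} {r k : ℕ}
    (hf : IsInitiallyRegular f r) (hfh : ∀ a < r, (f a).IsHomogeneous 2)
    (hxh : ∀ l < k, (x l).IsHomogeneous 1) :
    ∃ B ⊆ Finset.range r, r ≤ k + B.card ∧
      LinearIndepOn K (fun a => Ideal.Quotient.mkₐ K (initialIdeal x k) (f a)) (B : Set ℕ) := by
  obtain ⟨B, hBr, -, hspan, hli⟩ := exists_linearIndepOn_extension (K := K)
    (v := fun a => Ideal.Quotient.mkₐ K (initialIdeal x k) (f a))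
    (s := ∅) (t := (Finset.range r : Set ℕ)) (linearIndepOn_empty _ _) (Set.empty_subset _)
  lift B to Finset ℕ using (Finset.finite_toSet _).subset hBr
  refine ⟨B, by exact_mod_cast hBr, ?_, hli⟩
  classical
  let s : Finset (MvPolynomial σ K) := (Finset.range k).image x ∪ B.image f
  have hle : initialIdeal f r ≤ Ideal.span s := by
    have hxs : initialIdeal x k ≤ Ideal.span s := by
      refine Ideal.span_mono ?_
      simp [s]
    refine Ideal.span_le.2 ?_
    rintro _ ⟨a, ha, rfl⟩
    have h1 := hspan ⟨a, ha, rfl⟩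
    obtain ⟨g, hg⟩ := (Submodule.mem_span_image_finset_iff_exists_fun K).1 h1
    have h2 : f a - ∑ i : B, g i • f i ∈ initialIdeal x k := by
      rw [← Ideal.Quotient.eq_zero_iff_mem, ← Ideal.Quotient.mkₐ_eq_mk K, map_sub, map_sum,
        sub_eq_zero]
      simp only [map_smul]
      exact hg.symm
    have h3 : ∑ i : B, g i • f i ∈ Ideal.span (s : Set (MvPolynomial σ K)) := by
      refine Ideal.sum_mem _ fun i _ => ?_
      rw [smul_eq_C_mul]
      refine Ideal.mul_mem_left _ _ (Ideal.subset_span ?_)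
      simp only [s, Finset.coe_union, Finset.coe_image]
      exact Or.inr ⟨i, i.2, rfl⟩
    have := add_mem (hxs h2) h3
    rwa [sub_add_cancel] at this
  have hne : Ideal.span (s : Set (MvPolynomial σ K)) ≠ ⊤ := by
    have : Ideal.span (s : Set (MvPolynomial σ K)) ≤
        RingHom.ker (constantCoeff (σ := σ) (R := K)) := by
      refine Ideal.span_le.2 fun p hp => ?_
      have hp' : p ∈ (Finset.range k).image x ∪ B.image f := hp
      simp only [Finset.mem_union, Finset.mem_image, Finset.mem_range] at hp'
      rw [SetLike.mem_coe, RingHom.mem_ker, constantCoeff_eq]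
      rcases hp' with ⟨l, hl, rfl⟩ | ⟨a, ha, rfl⟩
      · exact (hxh l hl).coeff_eq_zero (by simp)
      · exact (hfh a (Finset.mem_range.1 (hBr ha))).coeff_eq_zero (by simp)
    exact fun h => RingHom.ker_ne_top _ (top_le_iff.1 (h ▸ this))
  have h1 : (r : ℕ∞) ≤ (k + B.card : ℕ) := by
    calc (r : ℕ∞) ≤ (initialIdeal f r).height := le_height_initialIdeal hf
      _ ≤ (Ideal.span (s : Set (MvPolynomial σ K))).height := Ideal.height_mono hle
      _ ≤ (Ideal.span (s : Set (MvPolynomial σ K))).spanRank.toENat :=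
        Ideal.height_le_spanRank_toENat _ hne
      _ ≤ s.card := by simpa using Submodule.spanRank_span_le_card (s : Set (MvPolynomial σ K))
      _ ≤ (k + B.card : ℕ) := by
        refine Nat.cast_le.2 ((Finset.card_union_le _ _).trans ?_)
        exact add_le_add (Finset.card_image_le.trans (by simp)) Finset.card_image_le
  exact_mod_cast h1

/-- Modulo a regular sequence of quadrics, the forms of degree `k` that are annihilated by `k`
independent linear forms span at most a line. -/
theorem exists_smul_add_smul_mem_initialIdeal [Finite σ] {f x : ℕ → MvPolynomial σ K} {r k : ℕ}
    (hf : IsInitiallyRegular f r) (hx : IsInitiallyRegular x k)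
    (hfh : ∀ a < r, (f a).IsHomogeneous 2) (hxh : ∀ l < k, (x l).IsHomogeneous 1)
    {z z' : MvPolynomial σ K} (hz : z.IsHomogeneous k) (hz' : z'.IsHomogeneous k)
    (hxz : ∀ l < k, x l * z ∈ initialIdeal f r) (hxz' : ∀ l < k, x l * z' ∈ initialIdeal f r) :
    ∃ s s' : K, (s ≠ 0 ∨ s' ≠ 0) ∧ s • z + s' • z' ∈ initialIdeal f r := by
  obtain ⟨B, hB, hBk, hli⟩ := exists_linearIndepOn_mkₐ hf hfh hxh
  have hlift : ∀ z : MvPolynomial σ K, z.IsHomogeneous k → (∀ l < k, x l * z ∈ initialIdeal f r) →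
      ∃ γ : Finset ℕ → K, IsCochain r k γ ∧ IsLift f x r k z fun T => C (γ T) := by
    intro z hz hxz
    obtain ⟨c, hc, _⟩ := exists_isLift hf hx hxz le_rfl
    have h := isLift_cochainComponent hfh hxh hz hc
    have hconst : cochainComponent ((k : ℤ) - k) c = fun T => C (coeff 0 (c T)) := by
      ext1 T
      rw [cochainComponent, sub_self, ← Nat.cast_zero, intComponent_natCast,
        homogeneousComponent_zero]
    rw [hconst] at h
    exact ⟨fun T => coeff 0 (c T), fun T hT => by
      simp [hc.isCochain T hT], h⟩
  obtain ⟨γ, hγ, hl⟩ := hlift z hz hxz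
  obtain ⟨γ', hγ', hl'⟩ := hlift z' hz' hxz'
  obtain ⟨s, s', hs, hss'⟩ : ∃ s s' : K, (s ≠ 0 ∨ s' ≠ 0) ∧
      s * γ (Finset.range r \ B) + s' * γ' (Finset.range r \ B) = 0 := by
    by_cases h : γ (Finset.range r \ B) = 0
    · exact ⟨1, 0, Or.inl one_ne_zero, by simp [h]⟩
    · exact ⟨-γ' (Finset.range r \ B), γ (Finset.range r \ B), Or.inr h, by ring⟩
  refine ⟨s, s', hs, ?_⟩
  have hcomb := hl.smul_add_smul (C s) (C s') hl'
  have hfun : ((C s • fun T => C (γ T)) + C s' • fun T => C (γ' T) :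
      Finset ℕ → MvPolynomial σ K) = fun T => C ((s • γ + s' • γ') T) := by
    ext1 T
    simp
  rw [hfun] at hcomb
  have hzero : s • γ + s' • γ' = 0 :=
    constant_cochain_eq_zero hB hBk hli ((hγ.smul s).add (hγ'.smul s')) hcomb.koszulD_mem
      (by simpa using hss')
  rw [hzero] at hcomb
  rw [smul_eq_C_mul, smul_eq_C_mul]
  refine hcomb.mem_initialIdeal_of_boundary hx le_rfl (e := 0) (fun _ _ => rfl) fun T => ?_
  simp

end MvPolynomial

/-! ### Annihilators in a complete intersection of quadrics -/

section CompleteIntersection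

open MvPolynomial KoszulCochain

variable {K : Type*} [Field K] {n : ℕ} {f : Fin (n + 1) → MvPolynomial (Fin (n + 1)) K}

theorem gradedPiece_eq_pow (f : Fin (n + 1) → MvPolynomial (Fin (n + 1)) K) (d : ℕ) :
    gradedPiece f d = gradedPiece f 1 ^ d := by
  rw [gradedPiece, gradedPiece, ← Submodule.map_pow, homogeneousSubmodule_one_pow]

theorem IsQuadricRegularSequence.isInitiallyRegular (hf : IsQuadricRegularSequence f) :
    IsInitiallyRegular (extendByZero f) (n + 1) :=
  isInitiallyRegular_extendByZero hf.isRegular.toIsWeaklyRegular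

theorem IsQuadricRegularSequence.isHomogeneous_extendByZero (hf : IsQuadricRegularSequence f) :
    ∀ a < n + 1, (extendByZero f a).IsHomogeneous 2 := fun a ha => by
  rw [extendByZero_of_lt f ha]
  exact hf.isHomogeneous _

theorem IsQuadricRegularSequence.nontrivial (hf : IsQuadricRegularSequence f) :
    Nontrivial (CIAlgebra f) := by
  refine Ideal.Quotient.nontrivial_iff.2 fun h => hf.isRegular.top_ne_smul ?_
  rw [smul_eq_mul, Ideal.mul_top, Ideal.ofList]
  refine h.symm.trans ?_
  congr 1
  ext p
  simp only [Set.mem_ofPred_eq, List.mem_ofFn, Set.mem_range]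

/-- Linearly independent elements of degree one lift to a regular sequence of linear forms. -/
theorem exists_linear_lift {k : ℕ} {b : Fin k → CIAlgebra f} (hb : ∀ i, b i ∈ gradedPiece f 1)
    (hli : LinearIndependent K b) :
    ∃ x : ℕ → MvPolynomial (Fin (n + 1)) K, (∀ l < k, (x l).IsHomogeneous 1) ∧
      IsInitiallyRegular x k ∧
        ∀ i : Fin k, Ideal.Quotient.mk (Ideal.span (Set.range f)) (x i) = b i := by
  choose y hy hyb using hb
  have hxy : ∀ i : Fin k, extendByZero y i = y i := fun i => extendByZero_of_lt y i.2
  have hxh : ∀ l < k, (extendByZero y l).IsHomogeneous 1 := fun l hl => by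
    rw [extendByZero_of_lt y hl]
    exact hy _
  refine ⟨extendByZero y, hxh, isInitiallyRegular_of_linearIndependent hxh ?_, fun i => ?_⟩
  · simp only [hxy]
    refine LinearIndependent.of_comp
      (Ideal.Quotient.mkₐ K (Ideal.span (Set.range f))).toLinearMap ?_
    rw [show (Ideal.Quotient.mkₐ K (Ideal.span (Set.range f))).toLinearMap ∘ y = b from funext hyb]
    exact hli
  · rw [hxy]
    exact hyb i

theorem mul_mk_eq_zero_iff {k : ℕ} {b : Fin k → CIAlgebra f}
    {x : ℕ → MvPolynomial (Fin (n + 1)) K}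
    (hx : ∀ i : Fin k, Ideal.Quotient.mk (Ideal.span (Set.range f)) (x i) = b i)
    (z : MvPolynomial (Fin (n + 1)) K) :
    (∀ i, b i * Ideal.Quotient.mk (Ideal.span (Set.range f)) z = 0) ↔
      ∀ l < k, x l * z ∈ initialIdeal (extendByZero f) (n + 1) := by
  rw [initialIdeal_extendByZero]
  simp only [← hx, ← map_mul, Ideal.Quotient.eq_zero_iff_mem]
  exact ⟨fun h l hl => h ⟨l, hl⟩, fun h i => h i i.2⟩

/-- Linearly independent elements `b i` of degree one, `k` in number, have no common annihilator in
degrees below `k`. -/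
theorem IsQuadricRegularSequence.eq_zero_of_forall_mul_eq_zero (hf : IsQuadricRegularSequence f)
    {k : ℕ} {b : Fin k → CIAlgebra f} (hb : ∀ i, b i ∈ gradedPiece f 1)
    (hli : LinearIndependent K b) {j : ℕ} (hj : j < k) {z : CIAlgebra f}
    (hz : z ∈ gradedPiece f j) (hbz : ∀ i, b i * z = 0) : z = 0 := by
  obtain ⟨x, hxh, hx, hxb⟩ := exists_linear_lift hb hli
  obtain ⟨p, hp, rfl⟩ := hz
  have h := mem_initialIdeal_of_forall_mul_mem hf.isInitiallyRegular hx
    hf.isHomogeneous_extendByZero hxh hj hp ((mul_mk_eq_zero_iff hxb p).1 hbz)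
  rw [initialIdeal_extendByZero] at h
  exact Ideal.Quotient.eq_zero_iff_mem.2 h

/-- Linearly independent elements `b i` of degree one, `k` in number, have at most a line of common
annihilators in degree `k`. -/
theorem IsQuadricRegularSequence.exists_forall_mem_span (hf : IsQuadricRegularSequence f)
    {k : ℕ} {b : Fin k → CIAlgebra f} (hb : ∀ i, b i ∈ gradedPiece f 1)
    (hli : LinearIndependent K b) :
    ∃ w : CIAlgebra f, ∀ z ∈ gradedPiece f k, (∀ i, b i * z = 0) → z ∈ Submodule.span K {w} := by
  obtain ⟨x, hxh, hx, hxb⟩ := exists_linear_lift hb hli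
  by_cases h : ∃ w ∈ gradedPiece f k, (∀ i, b i * w = 0) ∧ w ≠ 0
  · obtain ⟨w, hw, hbw, hw0⟩ := h
    refine ⟨w, fun z hz hbz => ?_⟩
    obtain ⟨q, hq, rfl⟩ := hw
    obtain ⟨p, hp, rfl⟩ := hz
    obtain ⟨s, s', hs, hss⟩ := exists_smul_add_smul_mem_initialIdeal hf.isInitiallyRegular hx
      hf.isHomogeneous_extendByZero hxh hp hq ((mul_mk_eq_zero_iff hxb p).1 hbz)
      ((mul_mk_eq_zero_iff hxb q).1 hbw)
    rw [initialIdeal_extendByZero] at hss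
    have h0 : s • Ideal.Quotient.mkₐ K (Ideal.span (Set.range f)) p +
        s' • Ideal.Quotient.mkₐ K (Ideal.span (Set.range f)) q = 0 := by
      rw [← map_smul, ← map_smul, ← map_add]
      exact Ideal.Quotient.eq_zero_iff_mem.2 hss
    have hs0 : s ≠ 0 := by
      rintro rfl
      rw [zero_smul, zero_add] at h0
      exact hw0 ((smul_eq_zero.1 h0).resolve_left (hs.resolve_left (not_not_intro rfl)))
    refine Submodule.mem_span_singleton.2 ⟨-(s⁻¹ * s'), ?_⟩
    have h1 := eq_neg_of_add_eq_zero_left h0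
    change -(s⁻¹ * s') • Ideal.Quotient.mkₐ K (Ideal.span (Set.range f)) q =
      Ideal.Quotient.mkₐ K (Ideal.span (Set.range f)) p
    rw [neg_smul, mul_smul, ← smul_neg, ← h1, smul_smul, inv_mul_cancel₀ hs0, one_smul]
  · refine ⟨0, fun z hz hbz => ?_⟩
    have : z = 0 := by
      by_contra hne
      exact h ⟨z, hz, hbz, hne⟩
    rw [this]
    exact Submodule.zero_mem _

end CompleteIntersection

/-! ### Polarization and powers on a linear space -/

section Polarization

variable {K R : Type*} [Field K] [CommRing R] [Algebra K R]

open Polynomial in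
/-- Apply a linear functional to all the coefficients of a univariate polynomial. -/
theorem exists_polynomial_eval_eq (φ : R →ₗ[K] K) (P : R[X]) :
    ∃ Q : K[X], (∀ i, Q.coeff i = φ (P.coeff i)) ∧
      ∀ t, Q.eval t = φ (P.eval (algebraMap K R t)) := by
  refine ⟨∑ i ∈ Finset.range (P.natDegree + 1), monomial i (φ (P.coeff i)), fun i => ?_,
    fun t => ?_⟩
  · rw [finsetSum_coeff]
    simp only [coeff_monomial]
    rw [Finset.sum_ite_eq']
    split_ifs with h
    · rfl
    · rw [coeff_eq_zero_of_natDegree_lt (by simpa using h), map_zero]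
  · rw [eval_finsetSum, eval_eq_sum_range, map_sum]
    refine Finset.sum_congr rfl fun i _ => ?_
    rw [eval_monomial, ← map_pow, mul_comm (P.coeff i), ← Algebra.smul_def, map_smul, smul_eq_mul,
      mul_comm]

open Polynomial in
theorem polynomial_eq_zero_of_infinite {P : R[X]} {s : Set K} (hs : s.Infinite)
    (h : ∀ t ∈ s, P.eval (algebraMap K R t) = 0) : P = 0 := by
  ext i
  rw [coeff_zero, ← Module.forall_dual_apply_eq_zero_iff K]
  intro φ
  obtain ⟨Q, hQ, hQe⟩ := exists_polynomial_eval_eq φ P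
  have hQ0 : Q = 0 := Q.eq_zero_of_infinite_isRoot <| hs.mono fun t ht => by
    change Q.eval t = 0
    rw [hQe, h t ht, map_zero]
  rw [← hQ, hQ0, coeff_zero]

open Polynomial in
/-- The polynomial `z * (x + X * y) ^ m`. -/
def linePow (z x y : R) (m : ℕ) : R[X] := C z * (C x + C y * X) ^ m

theorem eval_linePow (z x y : R) (m : ℕ) (t : K) :
    (linePow z x y m).eval (algebraMap K R t) = z * (x + t • y) ^ m := by
  rw [Algebra.smul_def, mul_comm _ y]
  simp [linePow]

theorem coeff_one_linePow (z x y : R) (m : ℕ) :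
    (linePow z x y (m + 1)).coeff 1 = (m + 1 : ℕ) • (z * x ^ m * y) := by
  have h := Polynomial.coeff_derivative (linePow z x y (m + 1)) 0
  rw [Polynomial.coeff_zero_eq_eval_zero] at h
  simp [linePow, Polynomial.derivative_pow] at h
  rw [linePow, Polynomial.coeff_C_mul, ← h, nsmul_eq_mul]
  push_cast
  ring

/-- Polarization: the coefficient of `t` in `z * (x + t • y) ^ (m + 1)` is `(m + 1) z x ^ m y`. -/
theorem mul_pow_mul_eq_zero [CharZero K] {z x y : R} {m : ℕ}
    (h : ∀ t : K, z * (x + t • y) ^ (m + 1) = 0) : z * x ^ m * y = 0 := by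
  have h0 : linePow z x y (m + 1) = 0 :=
    polynomial_eq_zero_of_infinite (K := K) Set.infinite_univ fun t _ => by
      rw [eval_linePow, h t]
  have h1 := coeff_one_linePow z x y m
  rw [h0, Polynomial.coeff_zero, ← Nat.cast_smul_eq_nsmul K] at h1
  exact (smul_eq_zero.1 h1.symm).resolve_left (Nat.cast_ne_zero.2 m.succ_ne_zero)

theorem mul_pow_eq_zero_of_infinite {z x y : R} {m : ℕ} {s : Set K} (hs : s.Infinite)
    (h : ∀ t ∈ s, z * (x + t • y) ^ m = 0) : z * x ^ m = 0 := by
  have h0 : linePow z x y m = 0 := polynomial_eq_zero_of_infinite hs fun t ht => by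
    rw [eval_linePow, h t ht]
  have h1 := eval_linePow z x y m (0 : K)
  rw [h0, Polynomial.eval_zero, zero_smul, add_zero] at h1
  exact h1.symm

theorem exists_apply_ne_zero_and {V : Type*} [AddCommGroup V] [Module K V] {f g : V →ₗ[K] K}
    (hf : f ≠ 0) (hg : g ≠ 0) : ∃ x, f x ≠ 0 ∧ g x ≠ 0 := by
  obtain ⟨a, ha⟩ : ∃ a, f a ≠ 0 := by
    by_contra! h
    exact hf (LinearMap.ext h)
  obtain ⟨b, hb⟩ : ∃ b, g b ≠ 0 := by
    by_contra! h
    exact hg (LinearMap.ext h)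
  by_cases hga : g a = 0
  · by_cases hfb : f b = 0
    · exact ⟨a + b, by simpa [hfb] using ha, by simpa [hga] using hb⟩
    · exact ⟨b, hfb, hb⟩
  · exact ⟨a, ha, hga⟩

theorem finite_setOf_apply_add_smul {V : Type*} [AddCommGroup V] [Module K V] {f : V →ₗ[K] K}
    (x : V) {x₀ : V} (h : f x₀ ≠ 0) : {t : K | f (x + t • x₀) = 0}.Finite := by
  refine Set.Subsingleton.finite fun t ht t' ht' => ?_
  simp only [Set.mem_ofPred_eq, map_add, map_smul, smul_eq_mul] at ht ht'
  exact mul_right_cancel₀ h (by linear_combination ht - ht')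

theorem coeff_applyCoeff {ι : Type*} (φ : R →ₗ[K] K) (p : MvPolynomial ι R) (m : ι →₀ ℕ) :
    (applyCoeff φ p).coeff m = φ (p.coeff m) := by
  classical
  rw [applyCoeff, MvPolynomial.coeff_sum]
  simp only [MvPolynomial.coeff_monomial]
  rw [Finset.sum_ite_eq']
  split_ifs with h
  · rfl
  · rw [MvPolynomial.notMem_support_iff.1 h, map_zero]

end Polarization

/-- A `k`-dimensional space `W` of elements of an algebra with `W ^ (k + 1) = 0`, such that nothing
in `W ^ j`, `j < k`, is annihilated by `W`, and the part of `W ^ k` annihilated by `W` is at most a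
line. This is the part of the duality of a complete intersection of quadrics that matters for
the nihilpotent loci. -/
structure IsSocleTight {K R : Type*} [Field K] [CommRing R] [Algebra K R] (W : Submodule K R)
    (k : ℕ) : Prop where
  finrank_eq : Module.finrank K W = k
  pow_succ_eq_zero : ∀ u ∈ W, u ^ (k + 1) = 0
  eq_zero_of_lt : ∀ j < k, ∀ z ∈ W ^ j, (∀ v ∈ W, z * v = 0) → z = 0
  exists_mem_span : ∃ w, ∀ z ∈ W ^ k, (∀ v ∈ W, z * v = 0) → z ∈ Submodule.span K {w}

namespace IsSocleTight

variable {K R : Type*} [Field K] [CharZero K] [CommRing R] [Algebra K R] {W : Submodule K R} {k : ℕ}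

theorem pow_mul_eq_zero (h : IsSocleTight W k) {u v : R} (hu : u ∈ W) (hv : v ∈ W) :
    u ^ k * v = 0 := by
  have := mul_pow_mul_eq_zero (K := K) (z := 1) (x := u) (y := v) (m := k) fun t => by
    rw [one_mul]
    exact h.pow_succ_eq_zero _ (W.add_mem hu (W.smul_mem t hv))
  rwa [one_mul] at this

theorem exists_pow_ne_zero [Nontrivial R] (h : IsSocleTight W k) : ∃ u ∈ W, u ^ k ≠ 0 := by
  by_contra! hk
  have key : ∀ j ≤ k, ∃ u ∈ W, u ^ j ≠ 0 := by
    intro j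
    induction j with
    | zero => exact fun _ => ⟨0, W.zero_mem, by simp⟩
    | succ j ih =>
      intro hj
      obtain ⟨u, hu, huj⟩ := ih (by omega)
      by_contra! hz
      refine huj (h.eq_zero_of_lt j (by omega) _ (Submodule.pow_mem_pow W hu j) fun v hv => ?_)
      have := mul_pow_mul_eq_zero (K := K) (z := 1) (x := u) (y := v) (m := j) fun t => by
        rw [one_mul]
        exact hz _ (W.add_mem hu (W.smul_mem t hv))
      rwa [one_mul] at this
  obtain ⟨u, hu, huk⟩ := key k le_rfl
  exact huk (hk u hu)

/-- For `m + 1 = k` this says that the form `u ↦ u ^ k` on `W` is not a cone. -/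
theorem eq_zero_of_forall_mul_pow (h : IsSocleTight W k) {m : ℕ} (hm : m < k) {y : R} (hy : y ∈ W)
    (hyu : ∀ u ∈ W, y * u ^ m = 0) : y = 0 := by
  induction m with
  | zero => simpa using hyu 0 W.zero_mem
  | succ m ih =>
    refine ih (by omega) fun u hu => h.eq_zero_of_lt (m + 1) hm _ ?_ fun v hv => ?_
    · rw [pow_succ']
      exact Submodule.mul_mem_mul hy (Submodule.pow_mem_pow W hu m)
    · exact mul_pow_mul_eq_zero (K := K) fun t => hyu _ (W.add_mem hu (W.smul_mem t hv))

/-- All `k`-th powers lie on one line, and so do their polarizations. -/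
theorem exists_pow_mem_span (h : IsSocleTight W k) :
    ∃ w, (∀ u ∈ W, u ^ k ∈ Submodule.span K {w}) ∧
      ∀ m, m + 1 = k → ∀ u ∈ W, ∀ y ∈ W, u ^ m * y ∈ Submodule.span K {w} := by
  obtain ⟨w, hw⟩ := h.exists_mem_span
  refine ⟨w, fun u hu => hw _ (Submodule.pow_mem_pow W hu k) fun v hv => h.pow_mul_eq_zero hu hv,
    ?_⟩
  rintro m rfl u hu y hy
  refine hw _ ?_ fun v hv => ?_
  · rw [pow_succ]
    exact Submodule.mul_mem_mul (Submodule.pow_mem_pow W hu m) hy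
  · have := mul_pow_mul_eq_zero (K := K) (z := v) (x := u) (y := y) (m := m) fun t => by
      rw [mul_comm]
      exact h.pow_mul_eq_zero (W.add_mem hu (W.smul_mem t hy)) hv
    rw [← this]
    ring

/-- The zeros of `u ↦ u ^ k` are not contained in two hyperplanes that meet outside `0`. Otherwise
the form would have no zeros on the lines in a common direction `y` of the two hyperplanes,
so it would be constant on them, and hence a cone with vertex `y`. -/
theorem exists_pow_eq_zero_of_apply [IsAlgClosed K] (h : IsSocleTight W k) (hk : k ≠ 0)
    {f g : W →ₗ[K] K} (hf : f ≠ 0) (hg : g ≠ 0) {y : W} (hy : y ≠ 0) (hfy : f y = 0)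
    (hgy : g y = 0) : ∃ v : W, (v : R) ^ k = 0 ∧ f v ≠ 0 ∧ g v ≠ 0 := by
  obtain ⟨m, rfl⟩ := Nat.exists_eq_succ_of_ne_zero hk
  obtain ⟨w, hw, hw'⟩ := h.exists_pow_mem_span
  by_contra! hcon
  have hgen : ∀ x : W, f x ≠ 0 → g x ≠ 0 → (y : R) * (x : R) ^ m = 0 := by
    intro x hfx hgx
    have hline : ∀ t : K, ((x : R) + t • (y : R)) ^ (m + 1) ≠ 0 := by
      intro t ht
      refine hgx ?_
      have := hcon (x + t • y) ht
      simp only [map_add, map_smul, hfy, hgy, smul_zero, add_zero] at this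
      exact this hfx
    obtain ⟨φ, hφ⟩ : ∃ φ : R →ₗ[K] K, φ w ≠ 0 := by
      by_contra! hφ
      have hw0 : w = 0 := (Module.forall_dual_apply_eq_zero_iff K w).1 hφ
      refine hline 0 ?_
      have := hw x x.2
      rw [hw0, Submodule.span_zero_singleton, Submodule.mem_bot] at this
      simpa using this
    have hφ0 : ∀ z ∈ Submodule.span K {w}, φ z = 0 → z = 0 := by
      intro z hz hz0
      obtain ⟨c, rfl⟩ := Submodule.mem_span_singleton.1 hz
      rw [map_smul, smul_eq_mul, mul_eq_zero] at hz0
      rw [hz0.resolve_right hφ, zero_smul]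
    obtain ⟨Q, hQ, hQe⟩ := exists_polynomial_eval_eq φ (linePow 1 (x : R) y (m + 1))
    -- a polynomial in `t` without roots is constant, so its linear coefficient vanishes
    have hdeg : Q.degree = 0 := by
      by_contra hne
      obtain ⟨t, ht⟩ := IsAlgClosed.exists_root Q hne
      rw [Polynomial.IsRoot, hQe, eval_linePow, one_mul] at ht
      exact hline t (hφ0 _ (hw _ (W.add_mem x.2 (W.smul_mem t y.2))) ht)
    have h1 := hQ 1
    rw [Polynomial.coeff_eq_zero_of_degree_lt (by rw [hdeg]; norm_num), coeff_one_linePow,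
      map_nsmul, one_mul, eq_comm, smul_eq_zero] at h1
    rw [mul_comm]
    exact hφ0 _ (hw' m rfl x x.2 y y.2) (h1.resolve_left m.succ_ne_zero)
  obtain ⟨x₀, hfx₀, hgx₀⟩ := exists_apply_ne_zero_and hf hg
  -- the identity `y * x ^ m = 0` extends from generic `x` to all `u`, along the line `u + t • x₀`
  refine hy (Subtype.ext (h.eq_zero_of_forall_mul_pow m.lt_succ_self y.2 fun u hu => ?_))
  refine mul_pow_eq_zero_of_infinite (K := K) (y := (x₀ : R))
    ((finite_setOf_apply_add_smul (f := f) ⟨u, hu⟩ hfx₀).union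
      (finite_setOf_apply_add_smul (f := g) ⟨u, hu⟩ hgx₀)).infinite_compl fun t ht => ?_
  simp only [Set.mem_compl_iff, Set.mem_union, Set.mem_ofPred_eq, not_or] at ht
  exact hgen (⟨u, hu⟩ + t • x₀) ht.1 ht.2

theorem exists_pow_eq_zero_notMem [IsAlgClosed K] (h : IsSocleTight W k) (hk : 2 ≤ k)
    {U H : Submodule K W} (hU : U ≠ ⊤) (hH : H ≠ ⊤) (hUH : U ≤ H ∨ 3 ≤ k) :
    ∃ v : W, (v : R) ^ k = 0 ∧ v ∉ U ∧ v ∉ H := by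
  have hfin : Module.Finite K W := Module.finite_of_finrank_pos (by rw [h.finrank_eq]; omega)
  obtain ⟨g, hg, hHg⟩ := Submodule.exists_le_ker_of_lt_top H (lt_top_iff_ne_top.2 hH)
  obtain ⟨f, hf, hUf, y, hy, hfy, hgy⟩ : ∃ f : W →ₗ[K] K, f ≠ 0 ∧ U ≤ LinearMap.ker f ∧
      ∃ y : W, y ≠ 0 ∧ f y = 0 ∧ g y = 0 := by
    rcases hUH with hUH | hk3
    · have hker : LinearMap.ker g ≠ ⊥ := LinearMap.ker_ne_bot_of_finrank_lt (by
        rw [h.finrank_eq, Module.finrank_self]; omega)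
      obtain ⟨y, hy, hy0⟩ := Submodule.exists_mem_ne_zero_of_ne_bot hker
      exact ⟨g, hg, hUH.trans hHg, y, hy0, hy, hy⟩
    · obtain ⟨f, hf, hUf⟩ := Submodule.exists_le_ker_of_lt_top U (lt_top_iff_ne_top.2 hU)
      have hker : LinearMap.ker (f.prod g) ≠ ⊥ := LinearMap.ker_ne_bot_of_finrank_lt (by
        rw [h.finrank_eq, Module.finrank_prod, Module.finrank_self]; omega)
      obtain ⟨y, hy, hy0⟩ := Submodule.exists_mem_ne_zero_of_ne_bot hker
      have hy' : f y = 0 ∧ g y = 0 := by simpa [LinearMap.mem_ker] using hy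
      exact ⟨f, hf, hUf, y, hy0, hy'.1, hy'.2⟩
  obtain ⟨v, hv, hfv, hgv⟩ := h.exists_pow_eq_zero_of_apply (by omega) hf hg hy hfy hgy
  exact ⟨v, hv, fun hvU => hfv (hUf hvU), fun hvH => hgv (hHg hvH)⟩

/-- Independent zeros of `u ↦ u ^ k` with a nonzero product, chosen one after the other:
each outside the span of the preceding ones and outside the annihilator of the product so far. -/
theorem exists_linearIndependent_prod_ne_zero [IsAlgClosed K] [Nontrivial R]
    (h : IsSocleTight W k) (hk : 2 ≤ k) :
    ∃ v : Fin k → W, (∀ i, (v i : R) ^ k = 0) ∧ LinearIndependent K v ∧ ∏ i, (v i : R) ≠ 0 := by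
  have hfin : Module.Finite K W := Module.finite_of_finrank_pos (by rw [h.finrank_eq]; omega)
  have key : ∀ i ≤ k, ∃ v : Fin i → W, (∀ j, (v j : R) ^ k = 0) ∧ LinearIndependent K v ∧
      ∃ u ∈ W, (∏ j, (v j : R)) * u ^ (k - i) ≠ 0 := by
    intro i
    induction i with
    | zero =>
      intro _
      obtain ⟨u, hu, huk⟩ := h.exists_pow_ne_zero
      exact ⟨Fin.elim0, fun j => j.elim0, linearIndependent_empty_type, u, hu, by simpa using huk⟩
    | succ i ih =>
      intro hi
      obtain ⟨v, hvk, hv, u, hu, hvu⟩ := ih (by omega)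
      obtain ⟨m, hm⟩ : ∃ m, k - i = m + 1 := ⟨k - i - 1, by omega⟩
      rw [hm] at hvu
      rw [pow_succ, ← mul_assoc] at hvu
      -- the next point must lie outside `H` and outside the span of the preceding ones
      let H : Submodule K W :=
        LinearMap.ker ((LinearMap.mulLeft K ((∏ j, (v j : R)) * u ^ m)).comp W.subtype)
      have hmemH : ∀ s : W, s ∈ H ↔ (∏ j, (v j : R)) * u ^ m * s = 0 := fun s => Iff.rfl
      have hH : H ≠ ⊤ := fun hH => hvu ((hmemH ⟨u, hu⟩).1 (hH ▸ Submodule.mem_top))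
      have hU : Submodule.span K (Set.range v) ≠ ⊤ := by
        intro hU
        have := finrank_span_eq_card hv
        rw [hU, finrank_top, h.finrank_eq, Fintype.card_fin] at this
        omega
      have hUH : Submodule.span K (Set.range v) ≤ H ∨ 3 ≤ k := by
        by_cases hk3 : 3 ≤ k
        · exact Or.inr hk3
        · -- for `k = 2` there is at most one earlier point, and it has square zero
          left
          obtain rfl : k = 2 := by omega
          rw [Submodule.span_le]
          rintro _ ⟨j, rfl⟩
          obtain rfl : i = 1 := by have := j.2; omega
          obtain rfl : m = 0 := by omega
          rw [SetLike.mem_coe, hmemH]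
          have := hvk 0
          rw [Subsingleton.elim j 0]
          simpa [sq] using this
      obtain ⟨s, hs, hsU, hsH⟩ := h.exists_pow_eq_zero_notMem hk hU hH hUH
      refine ⟨Fin.snoc v s, fun j => ?_, linearIndependent_finSnoc.2 ⟨hv, hsU⟩, u, hu, ?_⟩
      · refine Fin.lastCases ?_ (fun j => ?_) j
        · simpa using hs
        · simpa using hvk j
      · rw [Fin.prod_univ_castSucc]
        simp only [Fin.snoc_castSucc, Fin.snoc_last]
        rw [show k - (i + 1) = m by omega]
        intro h0
        refine hsH ((hmemH s).2 ?_)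
        rw [← h0]
        ring
  obtain ⟨v, hvk, hv, u, -, hvu⟩ := key k le_rfl
  exact ⟨v, hvk, hv, by simpa using hvu⟩

/-- In any basis of `W` the equations of `u ^ k = 0` are all proportional to one form. -/
theorem exists_nilpotentIdeal_eq_span [Nontrivial R] (h : IsSocleTight W k) {ι : Type*} [Fintype ι]
    {b : ι → R} (hb : Submodule.span K (Set.range b) = W) :
    ∃ p : MvPolynomial ι K, p ≠ 0 ∧ p.IsHomogeneous k ∧
      nilpotentIdeal (K := K) b k = Ideal.span {p} ∧
        ∀ a : ι → K, (∑ i, a i • b i) ^ k = 0 ↔ MvPolynomial.eval a p = 0 := by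
  obtain ⟨w, hw, -⟩ := h.exists_pow_mem_span
  obtain ⟨u, hu, huk⟩ := h.exists_pow_ne_zero
  have hmem : ∀ a : ι → K, ∑ i, a i • b i ∈ W := fun a => by
    rw [← hb]
    exact Submodule.sum_mem _ fun i _ => Submodule.smul_mem _ _ (Submodule.subset_span ⟨i, rfl⟩)
  obtain ⟨φ, hφ⟩ : ∃ φ : R →ₗ[K] K, φ w = 1 := by
    obtain ⟨φ, hφ⟩ : ∃ φ : R →ₗ[K] K, φ w ≠ 0 := by
      by_contra! hφ
      have hw0 : w = 0 := (Module.forall_dual_apply_eq_zero_iff K w).1 hφ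
      have := hw u hu
      rw [hw0, Submodule.span_zero_singleton, Submodule.mem_bot] at this
      exact huk this
    exact ⟨(φ w)⁻¹ • φ, by simp [hφ]⟩
  let P : MvPolynomial ι R := (∑ i, MvPolynomial.C (b i) * MvPolynomial.X i) ^ k
  have heval : ∀ (ψ : R →ₗ[K] K) (a : ι → K),
      MvPolynomial.eval a (applyCoeff ψ P) = ψ ((∑ i, a i • b i) ^ k) := by
    intro ψ a
    rw [eval_applyCoeff]
    simp [P, Algebra.smul_def, mul_comm]
  have hpow : ∀ a : ι → K, (∑ i, a i • b i) ^ k = φ ((∑ i, a i • b i) ^ k) • w := by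
    intro a
    obtain ⟨c, hc⟩ := Submodule.mem_span_singleton.1 (hw _ (hmem a))
    rw [← hc, map_smul, hφ, smul_eq_mul, mul_one]
  -- all generators of the ideal are multiples of the one given by `φ`
  have hψ : ∀ ψ : R →ₗ[K] K, applyCoeff ψ P = MvPolynomial.C (ψ w) * applyCoeff φ P := by
    intro ψ
    refine MvPolynomial.funext fun a => ?_
    rw [map_mul, MvPolynomial.eval_C, heval, heval, hpow a, map_smul, map_smul, hφ, smul_eq_mul,
      smul_eq_mul, mul_one, mul_comm]
  have hzero : ∀ a : ι → K, (∑ i, a i • b i) ^ k = 0 ↔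
      MvPolynomial.eval a (applyCoeff φ P) = 0 := by
    intro a
    rw [heval]
    refine ⟨fun h0 => by rw [h0, map_zero], fun h0 => ?_⟩
    rw [hpow a, h0, zero_smul]
  refine ⟨applyCoeff φ P, ?_, ?_, ?_, hzero⟩
  · intro h0
    rw [← hb] at hu
    obtain ⟨a, rfl⟩ := (Submodule.mem_span_range_iff_exists_fun K).1 hu
    exact huk ((hzero a).2 (by rw [h0, map_zero]))
  · have hP : P.IsHomogeneous k := by
      have h1 : (∑ i, MvPolynomial.C (b i) * MvPolynomial.X i : MvPolynomial ι R).IsHomogeneous 1 :=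
        MvPolynomial.IsHomogeneous.sum _ _ _ fun i _ => by
          simpa using (MvPolynomial.isHomogeneous_C ι (b i)).mul (MvPolynomial.isHomogeneous_X R i)
      simpa using h1.pow k
    intro m hm
    refine hP fun h0 => hm ?_
    rw [coeff_applyCoeff, h0, map_zero]
  · refine le_antisymm (Ideal.span_le.2 ?_) (Ideal.span_le.2 ?_)
    · rintro _ ⟨ψ, rfl⟩
      rw [SetLike.mem_coe, Ideal.mem_span_singleton]
      exact ⟨MvPolynomial.C (ψ w), by rw [mul_comm]; exact hψ ψ⟩
    · rintro _ rfl
      exact Ideal.subset_span ⟨φ, rfl⟩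

end IsSocleTight

/-! ### Linear subspaces of the nihilpotent locus -/

/-- The powers of a subspace of `R ^ 1` behave as the duality of the complete intersection `R`
predicts. -/
theorem IsQuadricRegularSequence.isSocleTight {K : Type*} [Field K] {n : ℕ}
    {f : Fin (n + 1) → MvPolynomial (Fin (n + 1)) K} (hf : IsQuadricRegularSequence f)
    {k : ℕ} (hk : k ≠ 0) {W : Submodule K (CIAlgebra f)} (hW : W ≤ gradedPiece f 1)
    (hdim : Module.finrank K W = k) (hpow : ∀ u ∈ W, u ^ (k + 1) = 0) : IsSocleTight W k := by
  have hfin : Module.Finite K W := Module.finite_of_finrank_pos (by omega)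
  let b := Module.finBasisOfFinrankEq K W hdim
  have hb : ∀ i, (b i : CIAlgebra f) ∈ gradedPiece f 1 := fun i => hW (b i).2
  have hli : LinearIndependent K fun i => (b i : CIAlgebra f) :=
    b.linearIndependent.map' W.subtype W.ker_subtype
  have hle : ∀ j, W ^ j ≤ gradedPiece f j := fun j => by
    rw [gradedPiece_eq_pow]
    exact pow_le_pow_left' hW j
  refine ⟨hdim, hpow, fun j hj z hz hzv => ?_, ?_⟩
  · exact hf.eq_zero_of_forall_mul_eq_zero hb hli hj (hle j hz) fun i => by
      rw [mul_comm]
      exact hzv _ (b i).2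
  · obtain ⟨w, hw⟩ := hf.exists_forall_mem_span hb hli
    exact ⟨w, fun z hz hzv => hw z (hle k hz) fun i => by
      rw [mul_comm]
      exact hzv _ (b i).2⟩

theorem span_range_basis_coe {K M ι : Type*} [Field K] [AddCommGroup M] [Module K M]
    {V : Submodule K M} {W : Submodule K V} (b : Module.Basis ι K W) :
    Submodule.span K (Set.range fun i => ((b i : V) : M)) = W.map V.subtype := by
  have h := congrArg (Submodule.map W.subtype) b.span_eq
  rw [Submodule.map_subtype_top, Submodule.map_span, ← Set.range_comp] at h
  refine Eq.trans ?_ (congrArg (Submodule.map V.subtype) h)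
  rw [Submodule.map_span, ← Set.range_comp]
  rfl

theorem mk_sum_smul_mem_nilpotentLocus {K R ι : Type*} [Field K] [CommRing R] [Algebra K R]
    [Fintype ι] {V : Submodule K R} (k : ℕ) (a : ι → K) (v : ι → V) (ha : ∑ i, a i • v i ≠ 0) :
    Projectivization.mk K (∑ i, a i • v i) ha ∈ nilpotentLocus V k ↔
      (∑ i, a i • (v i : R)) ^ k = 0 := by
  rw [mk_mem_nilpotentLocus]
  simp

/-- A linear subspace is spanned by the points of any basis of the underlying vector space. -/
theorem le_projectivization_span_range_mk {K V : Type*} [Field K] [AddCommGroup V] [Module K V]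
    {π : Projectivization.Subspace K V} {k : ℕ} (hk : k ≠ 0)
    (hdim : Module.finrank K (Projectivization.Subspace.submodule π) = k) {v : Fin k → V}
    (hv : ∀ i, v i ≠ 0) (hvπ : ∀ i, v i ∈ Projectivization.Subspace.submodule π)
    (hli : LinearIndependent K v) :
    π ≤ Projectivization.Subspace.span
      (Set.range fun i => Projectivization.mk K (v i) (hv i)) := by
  have hfin : Module.Finite K (Projectivization.Subspace.submodule π) :=
    Module.finite_of_finrank_pos (by omega)
  rw [← Projectivization.Subspace.submodule.le_iff_le]
  have hspan : Submodule.span K (Set.range v) = Projectivization.Subspace.submodule π := by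
    refine Submodule.eq_of_le_of_finrank_eq (Submodule.span_le.2 ?_) ?_
    · rintro _ ⟨i, rfl⟩
      exact hvπ i
    · rw [finrank_span_eq_card hli, hdim, Fintype.card_fin]
  rw [← hspan, Submodule.span_le]
  rintro _ ⟨i, rfl⟩
  rw [SetLike.mem_coe, Projectivization.Subspace.mem_submodule_iff _ (hv i)]
  exact Projectivization.Subspace.subset_span _ ⟨i, rfl⟩

end

theorem theorem2p6 {K : Type*} [Field K] [IsAlgClosed K] [CharZero K] {n : ℕ}
    (f : Fin (n + 1) → MvPolynomial (Fin (n + 1)) K) (hf : IsQuadricRegularSequence f)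
    (k : ℕ) (hk : 2 ≤ k)
    (π : Projectivization.Subspace K (gradedPiece f 1))
    (hdim : Module.finrank K (Projectivization.Subspace.submodule π) = k)
    (hπ : (π : Set (Projectivization K (gradedPiece f 1))) ⊆
      nilpotentLocus (gradedPiece f 1) (k + 1)) :
    -- (A) in any homogeneous coordinates on `π`, the scheme `π ∩ N_k` is cut out by one nonzero
    -- form of degree `k`, and its points are the zeros of this form
    (∀ b : Module.Basis (Fin k) K (Projectivization.Subspace.submodule π),
      ∃ p : MvPolynomial (Fin k) K, p ≠ 0 ∧ p.IsHomogeneous k ∧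
        nilpotentIdeal (fun i => ((b i : gradedPiece f 1) : CIAlgebra f)) k = Ideal.span {p} ∧
        ∀ (a : Fin k → K) (ha : (∑ i, a i • (b i : gradedPiece f 1)) ≠ 0),
          Projectivization.mk K (∑ i, a i • (b i : gradedPiece f 1)) ha ∈
              (π : Set (Projectivization K (gradedPiece f 1))) ∩
                nilpotentLocus (gradedPiece f 1) k ↔
            MvPolynomial.eval a p = 0) ∧
    -- (B) linearly independent points with nonzero product
    (∃ (v : Fin k → gradedPiece f 1) (hv : ∀ i, v i ≠ 0),
      (∀ i, Projectivization.mk K (v i) (hv i) ∈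
        (π : Set (Projectivization K (gradedPiece f 1))) ∩
          nilpotentLocus (gradedPiece f 1) k) ∧
      LinearIndependent K v ∧ ∏ i, (v i : CIAlgebra f) ≠ 0) ∧
    -- `π ∩ N_k` is nondegenerate in `π`
    Projectivization.Subspace.span
      ((π : Set (Projectivization K (gradedPiece f 1))) ∩
        nilpotentLocus (gradedPiece f 1) k) = π ∧
    -- `π` lies in the `k`-secant variety of `N_k`
    (π : Set (Projectivization K (gradedPiece f 1))) ⊆
      secantVariety k (nilpotentLocus (gradedPiece f 1) k) := by
  have := hf.nontrivial
  have hmem : ∀ (v : gradedPiece f 1) (hv : v ≠ 0), v ∈ Projectivization.Subspace.submodule π ↔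
      Projectivization.mk K v hv ∈ (π : Set (Projectivization K (gradedPiece f 1))) :=
    fun v hv => Projectivization.Subspace.mem_submodule_iff π hv
  have htight : IsSocleTight
      ((Projectivization.Subspace.submodule π).map (gradedPiece f 1).subtype) k := by
    refine hf.isSocleTight (by omega) ?_ ?_ ?_
    · exact Submodule.map_subtype_le _ _
    · rw [Submodule.finrank_map_subtype_eq, hdim]
    · rintro _ ⟨v, hv, rfl⟩
      by_cases hv0 : v = 0
      · simp [hv0]
      · exact (mk_mem_nilpotentLocus _ _ v hv0).1 (hπ ((hmem v hv0).1 hv))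
  obtain ⟨w, hwk, hwli, hwprod⟩ := htight.exists_linearIndependent_prod_ne_zero hk
  choose v hvπ hvw using fun i => (w i).2
  have hprod : ∏ i, (v i : CIAlgebra f) ≠ 0 := by
    rw [← Finset.prod_congr rfl fun i _ => hvw i] at hwprod
    exact hwprod
  have hli : LinearIndependent K v := by
    refine LinearIndependent.of_comp (gradedPiece f 1).subtype ?_
    rw [show (gradedPiece f 1).subtype ∘ v = fun i => (w i : CIAlgebra f) from funext hvw]
    exact hwli.map' _ (Submodule.ker_subtype _)
  have hv : ∀ i, v i ≠ 0 := hli.ne_zero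
  have hmemT : ∀ i, Projectivization.mk K (v i) (hv i) ∈
      (π : Set (Projectivization K (gradedPiece f 1))) ∩ nilpotentLocus (gradedPiece f 1) k := by
    refine fun i => ⟨(hmem _ _).1 (hvπ i), (mk_mem_nilpotentLocus _ _ _ _).2 ?_⟩
    have := hwk i
    rwa [← hvw i] at this
  have hspan := le_projectivization_span_range_mk (by omega) hdim hv hvπ hli
  refine ⟨fun b => ?_, ⟨v, hv, hmemT, hli, hprod⟩, le_antisymm ?_ (hspan.trans ?_), fun x hx => ?_⟩
  · obtain ⟨p, hp0, hp, hpI, hpz⟩ := htight.exists_nilpotentIdeal_eq_span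
      (b := fun i => ((b i : gradedPiece f 1) : CIAlgebra f)) (span_range_basis_coe b)
    refine ⟨p, hp0, hp, hpI, fun a ha => ?_⟩
    have haπ : ∑ i, a i • (b i : gradedPiece f 1) ∈ Projectivization.Subspace.submodule π :=
      Submodule.sum_mem _ fun i _ => Submodule.smul_mem _ _ (b i).2
    exact (and_iff_right ((hmem _ ha).1 haπ)).trans
      ((mk_sum_smul_mem_nilpotentLocus k a _ ha).trans (hpz a))
  · exact Projectivization.Subspace.span_le_subspace_iff.2 Set.inter_subset_left
  · refine Projectivization.Subspace.span_le_span ?_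
    rintro _ ⟨i, rfl⟩
    exact hmemT i
  · exact fun d F _ hF => hF x ⟨_, fun i => (hmemT i).2, hspan hx⟩
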